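/- Let $d\ge 0$ be an integer, let $\mathcal A$ be a finite set, let $\Lambda\colon\mathbb Z^d\to\mathcal A$ be a colouring, and let $\mathcal H$ be a finite-dimensional real or complex Hilbert space. Equip $\mathbb Z^d$ with the supremum metric, and write $|F|$ for the cardinality of a finite set $F$. A *box pattern at the origin* is a map $P\colon Q(P)\to\mathcal A$ whose domain is a box $Q(P)=\prod_{i=1}^d\{0,\dots,b_i\}$ with integers $b_i\ge 0$. It *occurs* in $\Lambda$ if there is $x\in\mathbb Z^d$ with $\Lambda(x+y)=P(y)$ for all $y\in Q(P)$. For a finite set $Q\subset\mathbb Z^d$ let $\sharp_P(\Lambda\cap Q)$ be the number of $x\in Q$ with $x+Q(P)\subset Q$ and $\Lambda(x+y)=P(y)$ for all $y\in Q(P)$. For an integer $S\ge0$ let $\partial^S Q$ be the set of the points outside $Q$ at distance at most $S$ from some point of $Q$, together with the points of $Q$ at distance at most $S$ from some point of $\mathbb Z^d\setminus Q$. Let $(Q_j)_{j\in\mathbb N}$ be a van Hove sequence, i.e. a sequence of nonempty finite subsets of $\mathbb Z^d$ with $\lim_{j\to\infty}|\partial^S Q_j|/|Q_j|=0$ for every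 $S$. Suppose that for every box pattern $P$ at the origin the frequency $\nu_P=\lim_{j\to\infty}|Q_j|^{-1}\,\sharp_P(\Lambda\cap Q_j)$ exists, and that $\nu_P>0$ whenever $P$ occurs in $\Lambda$. Let $H$ be a bounded selfadjoint operator on $\ell^2(\mathbb Z^d,\mathcal H)$. For $x\in\mathbb Z^d$ let $p_x u=u(x)$ and let $i_x\colon\mathcal H\to\ell^2(\mathbb Z^d,\mathcal H)$ be the adjoint of $p_x$. Suppose that - $H$ has finite range: there is $R>0$ such that $p_yHi_x=0$ whenever $x,y\in\mathbb Z^d$ have distance bigger than $R$; - $H$ is $\Lambda$-invariant: there is an integer $M\ge 0$ such that, with $C_M(x)=x+\{0,\dots,M-1\}^d$, one has $p_yHi_x=p_{y+t}Hi_{x+t}$ for all $x,y,t\in\mathbb Z^d$ with $\Lambda(z+t)=\Lambda(z)$ for all $z\in C_M(x)\cup C_M(y)$. For finite $Q\subset\mathbb Z^d$ let $p_QHi_Q$ be the compression of $H$ to the subspace $\ell^2(Q,\mathcal H)$ of the elements supported in $Q$. For a selfadjoint operator $T$ on a finite-dimensional Hilbert space and $E\in\mathbb R$ let $n(T)(E)$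 be the number of eigenvalues of $T$ not exceeding $E$, counted with multiplicity. Then there is exactly one function $N_H\colon\mathbb R\to\mathbb R$, the *integrated density of states* of $H$, that is the distribution function $E\mapsto\mu_H((-\infty,E])$ of a Borel measure $\mu_H$ on $\mathbb R$ of total mass $\dim\mathcal H$ and satisfies $\sup_{E\in\mathbb R}\bigl|\,|Q_j|^{-1}n(p_{Q_j}Hi_{Q_j})(E)-N_H(E)\bigr|\to0$ as $j\to\infty$. Moreover, for every $\lambda\in\mathbb R$ the following assertions are equivalent: 1. $\lambda$ is a point of discontinuity of $N_H$; 2. $H$ has a compactly supported eigenfunction with eigenvalue $\lambda$, i.e. there is $u\in\ell^2(\mathbb Z^d,\mathcal H)$ with $u\ne0$, $Hu=\lambda u$, and $u(x)\ne0$ for only finitely many $x$. -/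

import Mathlib

open scoped Pointwise
open Filter Topology MeasureTheory

noncomputable section

namespace FiniteRange

/-- The lattice `ℤ^d`, with the supremum metric. -/
abbrev Lattice (d : ℕ) : Type := Fin d → ℤ

/-! ### Patterns and frequencies -/

/-- A pattern: a map from a finite subset of `ℤ^d` to the set `A` of colours. -/
structure Pattern (d : ℕ) (A : Type*) where
  dom : Finset (Lattice d)
  color : dom → A

/-- The pattern `Λ ∩ Q`, the restriction of a colouring `Λ` to a finite set `Q`. -/
def restrict {d : ℕ} {A : Type*} (Λ : Lattice d → A) (Q : Finset (Lattice d)) : Pattern d A :=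
  ⟨Q, fun y => Λ y⟩

/-- `P` is a box pattern at the origin: its domain is `[0,b₁] × ⋯ × [0,b_d]` with integers
`b_j ≥ 0`. -/
def Pattern.IsBoxAtOrigin {d : ℕ} {A : Type*} (P : Pattern d A) : Prop :=
  ∃ b : Lattice d, 0 ≤ b ∧ P.dom = Finset.Icc 0 b

/-- The number of occurrences of `P` in `P'`: the number of `x` in the domain of `P'` such that
`x + Q(P) ⊆ Q(P')` and `P' ∩ (x + Q(P)) = x + P`. -/
def Pattern.count {d : ℕ} {A : Type*} (P P' : Pattern d A) : ℕ :=
  {x : Lattice d | x ∈ P'.dom ∧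
    ∀ y : P.dom, ∃ h : x + y ∈ P'.dom, P'.color ⟨x + y, h⟩ = P.color y}.ncard

/-- `P` occurs in the colouring `Λ`: `Λ ∩ (x + Q(P)) = x + P` for some `x`. -/
def Pattern.OccursIn {d : ℕ} {A : Type*} (P : Pattern d A) (Λ : Lattice d → A) : Prop :=
  ∃ x : Lattice d, ∀ y : P.dom, Λ (x + y) = P.color y

/-- The `S`-boundary of `Q`: the points outside `Q` at distance at most `S` from `Q` and the points
of `Q` at distance at most `S` from the complement of `Q`. -/
def boundary {d : ℕ} (S : ℕ) (Q : Finset (Lattice d)) : Set (Lattice d) :=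
  {x | x ∉ Q ∧ ∃ y ∈ Q, dist x y ≤ S} ∪ {x | x ∈ Q ∧ ∃ y, y ∉ Q ∧ dist x y ≤ S}

/-- Van Hove sequences of (nonempty) finite subsets of `ℤ^d`. -/
def IsVanHove {d : ℕ} (Q : ℕ → Finset (Lattice d)) : Prop :=
  (∀ j, (Q j).Nonempty) ∧
  ∀ S : ℕ, Tendsto (fun j => ((boundary S (Q j)).ncard : ℝ) / ((Q j).card : ℝ)) atTop (𝓝 0)

/-- `ν` is the frequency of `P` in `Λ` along `(Q_j)`. -/
def HasFrequency {d : ℕ} {A : Type*} (Λ : Lattice d → A) (Q : ℕ → Finset (Lattice d))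
    (P : Pattern d A) (ν : ℝ) : Prop :=
  Tendsto (fun j => (P.count (restrict Λ (Q j)) : ℝ) / ((Q j).card : ℝ)) atTop (𝓝 ν)

/-- The cube `C_M(x) = x + {0, …, M-1}^d`. -/
def cube {d : ℕ} (M : ℕ) (x : Lattice d) : Set (Lattice d) :=
  {z | ∀ i, x i ≤ z i ∧ z i < x i + M}

/-! ### Operators -/

section Operators

variable {𝕜 : Type*} [RCLike 𝕜] {d : ℕ} {𝓗 : Type*} [NormedAddCommGroup 𝓗]
  [InnerProductSpace 𝕜 𝓗]

/-- The Hilbert space `ℓ²(ℤ^d, 𝓗)`. -/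
abbrev EllTwo (d : ℕ) (𝓗 : Type*) [NormedAddCommGroup 𝓗] : Type _ :=
  lp (fun _ : Lattice d => 𝓗) 2

/-- The matrix element `p_y H i_x : 𝓗 → 𝓗`, where `p_y u = u y` and `i_x v` is the function that
has the value `v` at `x` and vanishes elsewhere. -/
def matrixElement (H : EllTwo d 𝓗 →L[𝕜] EllTwo d 𝓗) (y x : Lattice d) : 𝓗 →L[𝕜] 𝓗 :=
  lp.evalCLM 𝕜 (fun _ : Lattice d => 𝓗) 2 y ∘L H ∘L
    lp.singleContinuousLinearMap 𝕜 (fun _ : Lattice d => 𝓗) 2 x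

/-- `H` is of finite range: `p_y H i_x = 0` whenever `x`, `y` have distance bigger than some fixed
`R > 0`. -/
def IsFiniteRange (H : EllTwo d 𝓗 →L[𝕜] EllTwo d 𝓗) : Prop :=
  ∃ R : ℝ, 0 < R ∧ ∀ x y : Lattice d, R < dist x y → matrixElement H y x = 0

/-- `H` is `Λ`-invariant: for some `R`, `p_y H i_x = p_{y+t} H i_{x+t}` for all `x`, `y`, `t` such
that `t + (Λ ∩ (C_R(x) ∪ C_R(y))) = Λ ∩ (C_R(x+t) ∪ C_R(y+t))`. -/
def IsInvariant {A : Type*} (Λ : Lattice d → A) (H : EllTwo d 𝓗 →L[𝕜] EllTwo d 𝓗) : Prop :=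
  ∃ R : ℕ, ∀ x y t : Lattice d, (∀ z ∈ cube R x ∪ cube R y, Λ (z + t) = Λ z) →
    matrixElement H y x = matrixElement H (y + t) (x + t)

variable (𝕜 𝓗) in
/-- The closed subspace `ℓ²(Q, 𝓗)` of the elements of `ℓ²(ℤ^d, 𝓗)` supported in `Q`. -/
def supportedIn (Q : Set (Lattice d)) : Submodule 𝕜 (EllTwo d 𝓗) where
  carrier := {u | ∀ x, x ∉ Q → u x = 0}
  add_mem' := by
    intro u v hu hv x hx
    simp [hu x hx, hv x hx]
  zero_mem' := by
    intro x _
    simp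
  smul_mem' := by
    intro c u hu x hx
    simp [hu x hx]

theorem isClosed_supportedIn (Q : Set (Lattice d)) :
    IsClosed (supportedIn 𝕜 𝓗 Q : Set (EllTwo d 𝓗)) := by
  have h : (supportedIn 𝕜 𝓗 Q : Set (EllTwo d 𝓗)) =
      ⋂ x : Lattice d, ⋂ _ : x ∉ Q,
        {u | lp.evalCLM 𝕜 (fun _ : Lattice d => 𝓗) 2 x u = 0} := by
    ext u
    simp only [Set.mem_iInter, Set.mem_ofPred_eq]
    rfl
  rw [h]
  exact isClosed_iInter fun x => isClosed_iInter fun _ =>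
    isClosed_eq (ContinuousLinearMap.continuous _) continuous_const

instance completeSpace_supportedIn [CompleteSpace 𝓗] (Q : Set (Lattice d)) :
    CompleteSpace (supportedIn 𝕜 𝓗 Q) :=
  (isClosed_supportedIn Q).completeSpace_coe

/-- The operator `p_Q H i_Q` on `ℓ²(Q, 𝓗)`, where `p_Q` is the orthogonal projection onto
`ℓ²(Q, 𝓗)` and `i_Q` the inclusion. -/
def compression [CompleteSpace 𝓗] (H : EllTwo d 𝓗 →L[𝕜] EllTwo d 𝓗) (Q : Finset (Lattice d)) :
    supportedIn 𝕜 𝓗 (Q : Set (Lattice d)) →L[𝕜] supportedIn 𝕜 𝓗 (Q : Set (Lattice d)) :=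
  (supportedIn 𝕜 𝓗 (Q : Set (Lattice d))).orthogonalProjectionOnto ∘L H ∘L
    (supportedIn 𝕜 𝓗 (Q : Set (Lattice d))).subtypeL

/-- The cumulative eigenvalue counting function `n(T)(E)` of a selfadjoint operator `T` on a
finite-dimensional Hilbert space: the number of eigenvalues of `T` not exceeding `E`, each counted
with its multiplicity. The sum has only finitely many nonzero terms. -/
def eigenvalueCount {V : Type*} [AddCommGroup V] [Module 𝕜 V] (T : V →ₗ[𝕜] V) (E : ℝ) : ℕ :=
  ∑ᶠ (μ : ℝ) (_ : μ ≤ E), Module.finrank 𝕜 (Module.End.eigenspace T (μ : 𝕜))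

/-- `N` is the integrated density of states of `H` along `(Q_j)`: it is the distribution function
of a measure on `ℝ` (of total mass `dim 𝓗`), and `|Q_j|⁻¹ n(p_{Q_j} H i_{Q_j})` converges to `N`
with respect to the supremum norm. -/
def IsIDS [CompleteSpace 𝓗] (H : EllTwo d 𝓗 →L[𝕜] EllTwo d 𝓗) (Q : ℕ → Finset (Lattice d))
    (N : ℝ → ℝ) : Prop :=
  (∃ μ : Measure ℝ, μ Set.univ = (Module.finrank 𝕜 𝓗 : ENNReal) ∧
    ∀ E : ℝ, N E = μ.real (Set.Iic E)) ∧
  TendstoUniformly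
    (fun (j : ℕ) (E : ℝ) =>
      (eigenvalueCount (compression H (Q j)).toLinearMap E : ℝ) / ((Q j).card : ℝ))
    N atTop

/-- `H` has a compactly (that is, finitely) supported eigenfunction with eigenvalue `E`. -/
def HasFinitelySupportedEigenfunction (H : EllTwo d 𝓗 →L[𝕜] EllTwo d 𝓗) (E : ℝ) : Prop :=
  ∃ u : EllTwo d 𝓗, u ≠ 0 ∧ {x : Lattice d | u x ≠ 0}.Finite ∧ H u = (E : 𝕜) • u

end Operators

end FiniteRange

end

open scoped Pointwise
open Filter Topology MeasureTheory

noncomputable section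

namespace FiniteRange

/-! ### Eigenvalue counting for symmetric operators in finite dimension. -/

section Spectral

variable {𝕜 : Type*} [RCLike 𝕜] {V : Type*} [NormedAddCommGroup V] [InnerProductSpace 𝕜 V]
  [FiniteDimensional 𝕜 V] {T : V →ₗ[𝕜] V}

/-! Everything rests on the min-max principle: `countIn H Q E` is the largest dimension of a
subspace of `ℓ²(Q, 𝓗)` on which the form of `H` is at most `E`. Hence the count is monotone in `Q`,
changes by at most `dim 𝓗` per lattice point, and is additive over sets further apart than the range
of `H`.

Existence of the limit: the boxes of side `a` at the points of one residue class mod `a + s + 1` are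
decoupled. Averaging over all classes replaces the count on `Q` by a sum of box counts
(`sum_countIn_box_bounds`), with an error, relative to `|Q|`, from the gaps (small for large `a`)
and from the boundary. By invariance a box count depends only on nearby colours, so the sum is a
combination of pattern frequencies and converges uniformly in `E`.

Discontinuities: an eigenfunction of a compression that vanishes near the boundary is an
eigenfunction of `H`. If `H` has none of finite support, eigenspaces of compressions have dimension
`O(|∂Q|)`, so jumps vanish in the limit. Conversely, a finitely supported eigenfunction can be
copied wherever the surrounding colours recur; the copies are independent and recur with positive
frequency, which forces a jump. -/

theorem eigenvalueCount_eq_card {n : ℕ} (hT : T.IsSymmetric) (hn : Module.finrank 𝕜 V = n)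
    (E : ℝ) :
    eigenvalueCount T E = (Finset.univ.filter fun i => hT.eigenvalues hn i ≤ E).card := by
  classical
  have hf : ∀ μ : ℝ, Module.finrank 𝕜 (Module.End.eigenspace T (μ : 𝕜)) =
      (Finset.univ.filter fun i => hT.eigenvalues hn i = μ).card := by
    intro μ
    rw [← hT.card_filter_eigenvalues_eq hn (μ : 𝕜)]
    congr 1
    ext i
    simp
  set s := Finset.univ.filter fun i => hT.eigenvalues hn i ≤ E with hs
  unfold eigenvalueCount
  rw [Finset.card_eq_sum_card_image (hT.eigenvalues hn) s]
  have h1 : ∑ᶠ (μ : ℝ) (_ : μ ≤ E), Module.finrank 𝕜 (Module.End.eigenspace T (μ : 𝕜)) =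
      ∑ μ ∈ s.image (hT.eigenvalues hn), Module.finrank 𝕜 (Module.End.eigenspace T (μ : 𝕜)) := by
    refine finsum_mem_eq_sum_of_inter_support_eq (s := {μ : ℝ | μ ≤ E}) _ ?_
    ext μ
    simp only [Set.mem_inter_iff, Function.mem_support, hf, Finset.coe_image, Set.mem_image,
      ne_eq, Finset.card_eq_zero, Finset.filter_eq_empty_iff, not_forall, not_not]
    constructor
    · rintro ⟨h, i, -, hi⟩
      refine ⟨⟨i, ?_, hi⟩, i, Finset.mem_univ i, hi⟩
      rw [← hi] at h
      simpa [hs] using h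
    · rintro ⟨⟨i, hi, rfl⟩, h⟩
      exact ⟨by simpa [hs] using hi, h⟩
  rw [h1]
  refine Finset.sum_congr rfl fun μ hμ => ?_
  rw [hf]
  congr 1
  ext i
  obtain ⟨k, hk, rfl⟩ := Finset.mem_image.1 hμ
  simp only [hs, Finset.mem_filter, Finset.mem_univ, true_and] at hk ⊢
  exact ⟨fun h => ⟨h.le.trans hk, h⟩, fun h => h.2⟩

theorem re_inner_apply_eq_sum {n : ℕ} (hT : T.IsSymmetric) (hn : Module.finrank 𝕜 V = n) (u : V) :
    RCLike.re (inner 𝕜 (T u) u) =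
      ∑ i, hT.eigenvalues hn i * ‖inner 𝕜 (hT.eigenvectorBasis hn i) u‖ ^ 2 := by
  rw [← OrthonormalBasis.sum_inner_mul_inner (hT.eigenvectorBasis hn) (T u) u, map_sum]
  refine Finset.sum_congr rfl fun i _ => ?_
  rw [hT u, hT.apply_eigenvectorBasis hn, inner_smul_right, mul_assoc, RCLike.re_ofReal_mul,
    inner_mul_symm_re_eq_norm, norm_mul, norm_inner_symm, sq]

/-- The spectral subspaces below and above an energy. -/
theorem exists_spectral_subspaces (hT : T.IsSymmetric) (E : ℝ) :
    ∃ W₁ W₂ : Submodule 𝕜 V,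
      (∀ u ∈ W₁, RCLike.re (inner 𝕜 (T u) u) ≤ E * ‖u‖ ^ 2) ∧
      (∀ u ∈ W₂, u ≠ 0 → E * ‖u‖ ^ 2 < RCLike.re (inner 𝕜 (T u) u)) ∧
      Module.finrank 𝕜 W₁ = eigenvalueCount T E ∧
      Module.finrank 𝕜 W₁ + Module.finrank 𝕜 W₂ = Module.finrank 𝕜 V := by
  classical
  set e := hT.eigenvalues rfl with he
  set b := hT.eigenvectorBasis rfl with hb
  let S : Set (Fin (Module.finrank 𝕜 V)) → Submodule 𝕜 V := fun J => Submodule.span 𝕜 (b '' J)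
  have hcoef : ∀ J, ∀ u ∈ S J, ∀ i, i ∉ J → inner 𝕜 (b i) u = 0 := by
    intro J u hu i hi
    induction hu using Submodule.span_induction with
    | mem x hx =>
      obtain ⟨k, hk, rfl⟩ := hx
      exact b.orthonormal.2 (fun h => hi (h ▸ hk))
    | zero => simp
    | add x y _ _ hx hy => rw [inner_add_right, hx, hy, add_zero]
    | smul c x _ hx => rw [inner_smul_right, hx, mul_zero]
  have hrank : ∀ J : Finset (Fin (Module.finrank 𝕜 V)),
      Module.finrank 𝕜 (S J) = J.card := by
    intro J
    have h := finrank_span_finset_eq_card (R := 𝕜) (s := J.image b) (by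
      rw [Finset.coe_image]
      exact (b.orthonormal.linearIndependent.linearIndepOn_id).mono (Set.image_subset_range _ _))
    rw [Finset.coe_image, Finset.card_image_of_injective _
      b.orthonormal.linearIndependent.injective] at h
    exact h
  refine ⟨S ((Finset.univ.filter fun i => e i ≤ E : Finset _) : Set _),
    S ((Finset.univ.filter fun i => ¬ e i ≤ E : Finset _) : Set _), ?_, ?_, ?_, ?_⟩
  · intro u hu
    rw [re_inner_apply_eq_sum hT rfl, ← b.sum_sq_norm_inner_right u, Finset.mul_sum]
    refine Finset.sum_le_sum fun i _ => ?_
    by_cases hi : e i ≤ E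
    · exact mul_le_mul_of_nonneg_right hi (by positivity)
    · have := hcoef _ u hu i (by simpa using hi)
      rw [← hb, this]; simp
  · intro u hu hu0
    rw [re_inner_apply_eq_sum hT rfl, ← b.sum_sq_norm_inner_right u, Finset.mul_sum]
    have hle : ∀ i, i ∈ Finset.univ → E * ‖inner 𝕜 (b i) u‖ ^ 2 ≤
        e i * ‖inner 𝕜 (b i) u‖ ^ 2 := by
      intro i _
      by_cases hi : e i ≤ E
      · rw [hcoef _ u hu i (by simpa using hi)]; simp
      · exact mul_le_mul_of_nonneg_right (not_le.1 hi).le (by positivity)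
    refine Finset.sum_lt_sum hle ?_
    -- Strictness comes from one nonzero coefficient, whose eigenvalue must exceed `E`.
    obtain ⟨i, hi⟩ : ∃ i, inner 𝕜 (b i) u ≠ 0 := by
      by_contra! h
      apply hu0
      rw [← norm_eq_zero, ← sq_eq_zero_iff, ← b.sum_sq_norm_inner_right u]
      simp [h]
    refine ⟨i, Finset.mem_univ i, ?_⟩
    have hie : ¬ e i ≤ E := fun h => hi (hcoef _ u hu i (by simpa using h))
    exact mul_lt_mul_of_pos_right (not_le.1 hie) (by positivity)
  · rw [hrank, eigenvalueCount_eq_card hT rfl]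
  · rw [hrank, hrank, Finset.card_filter_add_card_filter_not, Finset.card_univ, Fintype.card_fin]

theorem eventually_eigenvalueCount_right (hT : T.IsSymmetric) (E : ℝ) :
    ∀ᶠ E' in 𝓝[≥] E, eigenvalueCount T E' = eigenvalueCount T E := by
  simp only [eigenvalueCount_eq_card hT rfl]
  have h : ∀ᶠ E' in 𝓝[≥] E, ∀ i, (hT.eigenvalues rfl i ≤ E' ↔ hT.eigenvalues rfl i ≤ E) := by
    refine eventually_all.2 fun i => ?_
    by_cases hi : hT.eigenvalues rfl i ≤ E
    · filter_upwards [self_mem_nhdsWithin] with E' hE'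
      exact ⟨fun _ => hi, fun _ => hi.trans hE'⟩
    · filter_upwards [nhdsWithin_le_nhds (Iio_mem_nhds (not_le.1 hi))] with E' hE'
      exact ⟨fun h => absurd h (not_le.2 hE'), fun h => absurd h hi⟩
  filter_upwards [h] with E' hE'
  simp only [hE']

/-- The spectrum is finite, so just below `E` only the eigenvalue `E` itself is lost. -/
theorem eventually_eigenvalueCount_left (hT : T.IsSymmetric) (E : ℝ) :
    ∀ᶠ E' in 𝓝[<] E, eigenvalueCount T E ≤
      eigenvalueCount T E' + Module.finrank 𝕜 (Module.End.eigenspace T (E : 𝕜)) := by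
  classical
  simp only [eigenvalueCount_eq_card hT rfl]
  have h : ∀ᶠ E' in 𝓝[<] E, ∀ i, (hT.eigenvalues rfl i < E → hT.eigenvalues rfl i ≤ E') := by
    refine eventually_all.2 fun i => ?_
    by_cases hi : hT.eigenvalues rfl i < E
    · filter_upwards [nhdsWithin_le_nhds (Ioi_mem_nhds hi)] with E' hE' _ using hE'.le
    · exact Eventually.of_forall fun E' h => absurd h hi
  filter_upwards [h] with E' hE'
  rw [← hT.card_filter_eigenvalues_eq rfl (E : 𝕜)]
  refine (Finset.card_le_card ?_).trans (Finset.card_union_le _ _)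
  intro i hi
  simp only [Finset.mem_filter, Finset.mem_univ, true_and, Finset.mem_union,
    RCLike.ofReal_inj] at hi ⊢
  rcases hi.lt_or_eq with h | h
  · exact Or.inl (hE' i h)
  · exact Or.inr h

theorem eigenvalueCount_mono (hT : T.IsSymmetric) : Monotone (eigenvalueCount T) := by
  intro E E' h
  rw [eigenvalueCount_eq_card hT rfl, eigenvalueCount_eq_card hT rfl]
  refine Finset.card_le_card fun i hi => ?_
  simp only [Finset.mem_filter, Finset.mem_univ, true_and] at hi ⊢
  exact hi.trans h

end Spectral

/-! ### Finitely supported functions, translations and the quadratic form. -/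

section Supported

variable {𝕜 : Type*} [RCLike 𝕜] {d : ℕ} {𝓗 : Type*} [NormedAddCommGroup 𝓗]
  [InnerProductSpace 𝕜 𝓗]

variable (𝕜 𝓗) in
/-- Restriction of an element of `ℓ²(ℤ^d, 𝓗)` to a finite set. -/
def restrictFinite (F : Finset (Lattice d)) : EllTwo d 𝓗 →ₗ[𝕜] (F → 𝓗) where
  toFun u x := u x
  map_add' u v := by ext x; simp
  map_smul' c u := by ext x; simp

theorem mem_supportedIn {Q : Set (Lattice d)} {u : EllTwo d 𝓗} :
    u ∈ supportedIn 𝕜 𝓗 Q ↔ ∀ x, x ∉ Q → u x = 0 := Iff.rfl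

theorem supportedIn_mono {Q Q' : Set (Lattice d)} (h : Q ⊆ Q') :
    supportedIn 𝕜 𝓗 Q ≤ supportedIn 𝕜 𝓗 Q' :=
  fun _ hu x hx => hu x fun hq => hx (h hq)

theorem ker_restrictFinite (F : Finset (Lattice d)) :
    LinearMap.ker (restrictFinite 𝕜 𝓗 F) = supportedIn 𝕜 𝓗 ((F : Set (Lattice d))ᶜ) := by
  ext u
  rw [LinearMap.mem_ker, mem_supportedIn]
  constructor
  · intro h x hx
    simp only [Set.mem_compl_iff, not_not, Finset.mem_coe] at hx
    exact congrFun h ⟨x, hx⟩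
  · intro h
    ext x
    exact h x (by simp)

theorem eq_sum_single {F : Finset (Lattice d)} {u : EllTwo d 𝓗}
    (hu : u ∈ supportedIn 𝕜 𝓗 (F : Set (Lattice d))) :
    u = ∑ x ∈ F, lp.single 2 x (u x) := by
  ext y
  rw [lp.coeFn_sum, Finset.sum_apply]
  by_cases hy : y ∈ F
  · rw [Finset.sum_eq_single y, lp.single_apply_self]
    · intro x _ hxy
      exact lp.single_apply_ne _ _ _ hxy.symm
    · exact fun h => absurd hy h
  · rw [hu y (by simpa using hy)]
    refine (Finset.sum_eq_zero fun x hx => lp.single_apply_ne _ _ _ ?_).symm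
    rintro rfl
    exact hy hx

variable (𝕜 𝓗) in
/-- `ℓ²(F, 𝓗)` is the space of all functions on the finite set `F`. -/
def supportedInEquiv (F : Finset (Lattice d)) :
    supportedIn 𝕜 𝓗 (F : Set (Lattice d)) ≃ₗ[𝕜] (F → 𝓗) :=
  LinearEquiv.ofBijective ((restrictFinite 𝕜 𝓗 F).domRestrict _) <| by
    constructor
    · rw [← LinearMap.ker_eq_bot, LinearMap.ker_eq_bot']
      intro u hu
      ext y
      by_cases hy : y ∈ F
      · exact congrFun hu ⟨y, hy⟩
      · exact u.2 y (by simpa using hy)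
    · intro f
      refine ⟨⟨∑ x : F, lp.single 2 x (f x), fun y hy => ?_⟩, ?_⟩
      · rw [lp.coeFn_sum, Finset.sum_apply]
        refine Finset.sum_eq_zero fun x _ => lp.single_apply_ne _ _ _ ?_
        rintro rfl
        exact hy (by simp)
      · ext y
        change (∑ x : F, lp.single 2 (x : Lattice d) (f x) : EllTwo d 𝓗) y = f y
        rw [lp.coeFn_sum, Finset.sum_apply, Finset.sum_eq_single y]
        · rw [lp.single_apply_self]
        · intro x _ hxy
          exact lp.single_apply_ne _ _ _ fun h => hxy (Subtype.ext h.symm)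
        · exact fun h => absurd (Finset.mem_univ y) h

instance finiteDimensional_supportedIn [FiniteDimensional 𝕜 𝓗] (F : Finset (Lattice d)) :
    FiniteDimensional 𝕜 (supportedIn 𝕜 𝓗 (F : Set (Lattice d))) :=
  (supportedInEquiv 𝕜 𝓗 F).symm.finiteDimensional

theorem finrank_supportedIn [FiniteDimensional 𝕜 𝓗] (F : Finset (Lattice d)) :
    Module.finrank 𝕜 (supportedIn 𝕜 𝓗 (F : Set (Lattice d))) =
      F.card * Module.finrank 𝕜 𝓗 := by
  rw [(supportedInEquiv 𝕜 𝓗 F).finrank_eq, Module.finrank_pi_fintype]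
  simp

theorem finiteDimensional_of_le [FiniteDimensional 𝕜 𝓗] {F : Finset (Lattice d)}
    {W : Submodule 𝕜 (EllTwo d 𝓗)} (hW : W ≤ supportedIn 𝕜 𝓗 (F : Set (Lattice d))) :
    FiniteDimensional 𝕜 W :=
  Submodule.finiteDimensional_of_le hW

/-- Prescribing zeros on `F` lowers the dimension by at most `|F| dim 𝓗`. -/
theorem finrank_le_finrank_inf_add [FiniteDimensional 𝕜 𝓗] (W : Submodule 𝕜 (EllTwo d 𝓗))
    [FiniteDimensional 𝕜 W] (F : Finset (Lattice d)) :
    Module.finrank 𝕜 W ≤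
      Module.finrank 𝕜 (W ⊓ supportedIn 𝕜 𝓗 ((F : Set (Lattice d))ᶜ) : Submodule 𝕜 _) +
        F.card * Module.finrank 𝕜 𝓗 := by
  -- Rank-nullity for restriction to `F`: the kernel consists of the functions vanishing on `F`.
  have h := LinearMap.finrank_range_add_finrank_ker ((restrictFinite 𝕜 𝓗 F).domRestrict W)
  have hk : Module.finrank 𝕜 (LinearMap.ker ((restrictFinite 𝕜 𝓗 F).domRestrict W)) =
      Module.finrank 𝕜 (W ⊓ supportedIn 𝕜 𝓗 ((F : Set (Lattice d))ᶜ) : Submodule 𝕜 _) := by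
    rw [LinearMap.ker_domRestrict, ker_restrictFinite, ← Submodule.map_comap_subtype]
    exact (Submodule.finrank_map_subtype_eq _ _).symm
  have hr : Module.finrank 𝕜 (LinearMap.range ((restrictFinite 𝕜 𝓗 F).domRestrict W)) ≤
      F.card * Module.finrank 𝕜 𝓗 := by
    refine (Submodule.finrank_le _).trans (le_of_eq ?_)
    rw [Module.finrank_pi_fintype]
    simp
  omega

theorem inner_eq_sum {F : Finset (Lattice d)} (w : EllTwo d 𝓗) {v : EllTwo d 𝓗}
    (hv : v ∈ supportedIn 𝕜 𝓗 (F : Set (Lattice d))) :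
    inner 𝕜 w v = ∑ y ∈ F, inner 𝕜 (w y) (v y) := by
  refine (lp.hasSum_inner w v).unique (hasSum_sum_of_ne_finset_zero fun y hy => ?_)
  rw [hv y (by simpa using hy), inner_zero_right]

theorem apply_eq_sum (H : EllTwo d 𝓗 →L[𝕜] EllTwo d 𝓗) {F : Finset (Lattice d)} {u : EllTwo d 𝓗}
    (hu : u ∈ supportedIn 𝕜 𝓗 (F : Set (Lattice d))) (y : Lattice d) :
    H u y = ∑ x ∈ F, matrixElement H y x (u x) := by
  conv_lhs => rw [eq_sum_single hu]
  rw [map_sum, lp.coeFn_sum, Finset.sum_apply]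
  rfl

/-- Translation by `t` on `ℓ²(ℤ^d, 𝓗)`. -/
def translate (t : Lattice d) : EllTwo d 𝓗 →ₗ[𝕜] EllTwo d 𝓗 where
  toFun u := ⟨fun x => u (x - t), by
    have h := lp.memℓp u
    rw [memℓp_gen_iff (by norm_num)] at h
    exact (memℓp_gen_iff (by norm_num)).2 (h.comp_injective (Equiv.subRight t).injective)⟩
  map_add' u v := rfl
  map_smul' c u := rfl

@[simp]
theorem translate_apply (t : Lattice d) (u : EllTwo d 𝓗) (x : Lattice d) :
    (translate (𝕜 := 𝕜) t u) x = u (x - t) := rfl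

theorem translate_injective (t : Lattice d) :
    Function.Injective (translate (𝕜 := 𝕜) (𝓗 := 𝓗) t) := by
  intro u v h
  ext x
  have := congrArg (fun w : EllTwo d 𝓗 => w (x + t)) h
  simpa using this

theorem translate_mem_supportedIn {t : Lattice d} {F F' : Finset (Lattice d)}
    (hF : ∀ x, x ∈ F ↔ x + t ∈ F') {u : EllTwo d 𝓗}
    (hu : u ∈ supportedIn 𝕜 𝓗 (F : Set (Lattice d))) :
    translate (𝕜 := 𝕜) t u ∈ supportedIn 𝕜 𝓗 (F' : Set (Lattice d)) := by
  intro x hx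
  refine hu (x - t) fun h => hx ?_
  have := (hF (x - t)).1 h
  simpa using this

theorem apply_translate (H : EllTwo d 𝓗 →L[𝕜] EllTwo d 𝓗) {F : Finset (Lattice d)}
    {u : EllTwo d 𝓗} (hu : u ∈ supportedIn 𝕜 𝓗 (F : Set (Lattice d))) {t y : Lattice d}
    (h : ∀ x ∈ F, matrixElement H y x = matrixElement H (y + t) (x + t)) :
    H (translate (𝕜 := 𝕜) t u) (y + t) = H u y := by
  have hF : ∀ x, x ∈ F ↔ x + t ∈ F.map (addRightEmbedding t) := by
    intro x
    simp
  rw [apply_eq_sum H (translate_mem_supportedIn hF hu), apply_eq_sum H hu, Finset.sum_map]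
  refine Finset.sum_congr rfl fun x hx => ?_
  simp [h x hx]

theorem finrank_add_finrank_le {Q : Finset (Lattice d)} {W W' V : Submodule 𝕜 (EllTwo d 𝓗)}
    (hW : W ≤ supportedIn 𝕜 𝓗 (Q : Set (Lattice d)))
    (hW' : W' ≤ supportedIn 𝕜 𝓗 (Q : Set (Lattice d))) (hWV : W ≤ V) (hWV' : W' ≤ V)
    [FiniteDimensional 𝕜 𝓗] [FiniteDimensional 𝕜 V] (h : ∀ u ∈ W, u ∈ W' → u = 0) :
    Module.finrank 𝕜 W + Module.finrank 𝕜 W' ≤ Module.finrank 𝕜 V := by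
  have := finiteDimensional_of_le hW
  have := finiteDimensional_of_le hW'
  have hinf : W ⊓ W' = ⊥ := by
    rw [Submodule.eq_bot_iff]
    exact fun u hu => h u hu.1 hu.2
  have := Submodule.finrank_sup_add_finrank_inf_eq W W'
  rw [hinf, finrank_bot, add_zero] at this
  rw [← this]
  exact Submodule.finrank_mono (sup_le hWV hWV')

/-- The quadratic form of `H`. -/
def energy (H : EllTwo d 𝓗 →L[𝕜] EllTwo d 𝓗) (u : EllTwo d 𝓗) : ℝ :=
  RCLike.re (inner 𝕜 (H u) u)

theorem energy_le (H : EllTwo d 𝓗 →L[𝕜] EllTwo d 𝓗) (u : EllTwo d 𝓗) :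
    |energy H u| ≤ ‖H‖ * ‖u‖ ^ 2 := by
  refine (RCLike.abs_re_le_norm _).trans ((norm_inner_le_norm _ _).trans ?_)
  rw [sq, ← mul_assoc]
  exact mul_le_mul_of_nonneg_right (H.le_opNorm u) (norm_nonneg u)

/-- An integer range can serve as boundary width and as spacing of boxes. -/
theorem IsFiniteRange.exists_nat {H : EllTwo d 𝓗 →L[𝕜] EllTwo d 𝓗} (hfin : IsFiniteRange H) :
    ∃ s : ℕ, ∀ x y : Lattice d, (s : ℝ) < dist x y → matrixElement H y x = 0 := by
  obtain ⟨R, -, hR⟩ := hfin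
  obtain ⟨s, hs⟩ := exists_nat_ge R
  exact ⟨s, fun x y hxy => hR x y (hs.trans_lt hxy)⟩

end Supported

/-! ### Min-max principle and its consequences for compressions. -/

section Variational

variable {𝕜 : Type*} [RCLike 𝕜] {d : ℕ} {𝓗 : Type*} [NormedAddCommGroup 𝓗]
  [InnerProductSpace 𝕜 𝓗] [CompleteSpace 𝓗]

/-- The eigenvalue counting function of the compression of `H` to `ℓ²(Q, 𝓗)`. -/
def countIn (H : EllTwo d 𝓗 →L[𝕜] EllTwo d 𝓗) (Q : Finset (Lattice d)) (E : ℝ) : ℕ :=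
  eigenvalueCount (compression H Q).toLinearMap E

theorem inner_compression (H : EllTwo d 𝓗 →L[𝕜] EllTwo d 𝓗) (Q : Finset (Lattice d))
    (u v : supportedIn 𝕜 𝓗 (Q : Set (Lattice d))) :
    inner 𝕜 (compression H Q u) v = inner 𝕜 (H u) (v : EllTwo d 𝓗) :=
  Submodule.inner_orthogonalProjectionOnto_eq_of_mem_right v (H u)

theorem isSymmetric_compression {H : EllTwo d 𝓗 →L[𝕜] EllTwo d 𝓗} (hsa : IsSelfAdjoint H)
    (Q : Finset (Lattice d)) : (compression H Q).toLinearMap.IsSymmetric := by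
  intro u v
  have h1 := inner_compression H Q u v
  have h2 := inner_compression H Q v u
  have h3 : inner 𝕜 (H u) (v : EllTwo d 𝓗) = inner 𝕜 (u : EllTwo d 𝓗) (H v) :=
    hsa.isSymmetric (u : EllTwo d 𝓗) v
  change inner 𝕜 (compression H Q u) v = inner 𝕜 u (compression H Q v)
  rw [h1, h3, ← inner_conj_symm, ← h2, inner_conj_symm]

variable [FiniteDimensional 𝕜 𝓗] {H : EllTwo d 𝓗 →L[𝕜] EllTwo d 𝓗}

/-- The form of the compression is that of `H`, so the spectral subspaces can be placed in the full
space, where different sets `Q` become comparable. -/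
theorem exists_subspaces_countIn (hsa : IsSelfAdjoint H) (Q : Finset (Lattice d)) (E : ℝ) :
    ∃ W₁ W₂ : Submodule 𝕜 (EllTwo d 𝓗),
      W₁ ≤ supportedIn 𝕜 𝓗 (Q : Set (Lattice d)) ∧
      W₂ ≤ supportedIn 𝕜 𝓗 (Q : Set (Lattice d)) ∧
      (∀ u ∈ W₁, energy H u ≤ E * ‖u‖ ^ 2) ∧
      (∀ u ∈ W₂, u ≠ 0 → E * ‖u‖ ^ 2 < energy H u) ∧
      Module.finrank 𝕜 W₁ = countIn H Q E ∧
      countIn H Q E + Module.finrank 𝕜 W₂ = Q.card * Module.finrank 𝕜 𝓗 := by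
  obtain ⟨W₁, W₂, h₁, h₂, hn, hs⟩ := exists_spectral_subspaces (isSymmetric_compression hsa Q) E
  refine ⟨W₁.map (Submodule.subtype _), W₂.map (Submodule.subtype _),
    Submodule.map_subtype_le _ _, Submodule.map_subtype_le _ _, ?_, ?_, ?_, ?_⟩
  · rintro _ ⟨u, hu, rfl⟩
    have := h₁ u hu
    rwa [ContinuousLinearMap.coe_coe, inner_compression] at this
  · rintro _ ⟨u, hu, rfl⟩ h0
    have := h₂ u hu fun h => h0 (by simp [h])
    rwa [ContinuousLinearMap.coe_coe, inner_compression] at this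
  · rw [Submodule.finrank_map_subtype_eq, hn, countIn]
  · rw [Submodule.finrank_map_subtype_eq, countIn, ← hn, hs, finrank_supportedIn]

/-- `W` meets the spectral subspace above `E` only in `0`, and the codimension of that subspace is
the count. -/
theorem finrank_le_countIn (hsa : IsSelfAdjoint H) {Q : Finset (Lattice d)} {E : ℝ}
    {W : Submodule 𝕜 (EllTwo d 𝓗)} (hW : W ≤ supportedIn 𝕜 𝓗 (Q : Set (Lattice d)))
    (h : ∀ u ∈ W, energy H u ≤ E * ‖u‖ ^ 2) : Module.finrank 𝕜 W ≤ countIn H Q E := by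
  obtain ⟨W₁, W₂, -, hW₂, -, h₂, -, hs⟩ := exists_subspaces_countIn hsa Q E
  have := finrank_add_finrank_le hW hW₂ hW hW₂ fun u hu hu' => by
    by_contra h0
    exact absurd (h u hu) (not_le.2 (h₂ u hu' h0))
  rw [finrank_supportedIn] at this
  omega

theorem finrank_add_countIn_le (hsa : IsSelfAdjoint H) {Q : Finset (Lattice d)} {E : ℝ}
    {W : Submodule 𝕜 (EllTwo d 𝓗)} (hW : W ≤ supportedIn 𝕜 𝓗 (Q : Set (Lattice d)))
    (h : ∀ u ∈ W, u ≠ 0 → E * ‖u‖ ^ 2 < energy H u) :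
    countIn H Q E + Module.finrank 𝕜 W ≤ Q.card * Module.finrank 𝕜 𝓗 := by
  obtain ⟨W₁, W₂, hW₁, -, h₁, -, hn, -⟩ := exists_subspaces_countIn hsa Q E
  have := finrank_add_finrank_le hW₁ hW hW₁ hW fun u hu hu' => by
    by_contra h0
    exact absurd (h₁ u hu) (not_le.2 (h u hu' h0))
  rwa [finrank_supportedIn, hn] at this

theorem countIn_le (hsa : IsSelfAdjoint H) (Q : Finset (Lattice d)) (E : ℝ) :
    countIn H Q E ≤ Q.card * Module.finrank 𝕜 𝓗 := by
  obtain ⟨W₁, W₂, -, -, -, -, -, hs⟩ := exists_subspaces_countIn hsa Q E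
  omega

theorem countIn_mono_set (hsa : IsSelfAdjoint H) {Q Q' : Finset (Lattice d)} (h : Q' ⊆ Q)
    (E : ℝ) : countIn H Q' E ≤ countIn H Q E := by
  obtain ⟨W₁, W₂, hW₁, -, h₁, -, hn, -⟩ := exists_subspaces_countIn hsa Q' E
  rw [← hn]
  exact finrank_le_countIn hsa (hW₁.trans (supportedIn_mono (by exact_mod_cast h))) h₁

/-- Requiring zeros on `Q \ Q'` costs at most `dim 𝓗` dimensions per point and leaves functions
supported in `Q'`. -/
theorem countIn_le_add (hsa : IsSelfAdjoint H) (Q Q' : Finset (Lattice d))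
    (E : ℝ) : countIn H Q E ≤ countIn H Q' E + (Q \ Q').card * Module.finrank 𝕜 𝓗 := by
  obtain ⟨W₁, W₂, hW₁, -, h₁, -, hn, -⟩ := exists_subspaces_countIn hsa Q E
  have := finiteDimensional_of_le hW₁
  rw [← hn]
  refine (finrank_le_finrank_inf_add W₁ (Q \ Q')).trans (Nat.add_le_add_right ?_ _)
  refine finrank_le_countIn hsa ?_ fun u hu => h₁ u hu.1
  intro u hu x hx
  by_cases hxQ : x ∈ Q
  · exact hu.2 x (by simpa using ⟨hxQ, hx⟩)
  · exact hW₁ hu.1 x (by simpa using hxQ)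

theorem countIn_of_norm_le (hsa : IsSelfAdjoint H) (Q : Finset (Lattice d)) {E : ℝ}
    (hE : ‖H‖ ≤ E) : countIn H Q E = Q.card * Module.finrank 𝕜 𝓗 := by
  refine le_antisymm (countIn_le hsa Q E) ?_
  rw [← finrank_supportedIn (𝕜 := 𝕜) (𝓗 := 𝓗)]
  refine finrank_le_countIn hsa le_rfl fun u _ => ?_
  exact (le_abs_self _).trans ((energy_le H u).trans
    (mul_le_mul_of_nonneg_right hE (by positivity)))

theorem countIn_of_lt_neg_norm (hsa : IsSelfAdjoint H) (Q : Finset (Lattice d)) {E : ℝ}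
    (hE : E < -‖H‖) : countIn H Q E = 0 := by
  have := finrank_add_countIn_le (E := E) hsa (le_refl (supportedIn 𝕜 𝓗 (Q : Set (Lattice d))))
    fun u _ h0 => by
      have h1 := neg_le_of_abs_le (energy_le H u)
      have h2 : 0 < ‖u‖ ^ 2 := by have := norm_pos_iff.2 h0; positivity
      nlinarith
  rw [finrank_supportedIn] at this
  omega

theorem countIn_mono (hsa : IsSelfAdjoint H) (Q : Finset (Lattice d)) : Monotone (countIn H Q) :=
  eigenvalueCount_mono (isSymmetric_compression hsa Q)

/-- A space of eigenfunctions supported in `Q` produces a jump of the counting function. -/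
theorem countIn_add_finrank_le (hsa : IsSelfAdjoint H) {Q : Finset (Lattice d)} {E E' : ℝ}
    (hE : E' < E) {W : Submodule 𝕜 (EllTwo d 𝓗)}
    (hW : W ≤ supportedIn 𝕜 𝓗 (Q : Set (Lattice d))) (h : ∀ u ∈ W, H u = (E : 𝕜) • u) :
    countIn H Q E' + Module.finrank 𝕜 W ≤ countIn H Q E := by
  obtain ⟨W₁, W₂, hW₁, -, h₁, -, hn, -⟩ := exists_subspaces_countIn hsa Q E'
  have hfd := finiteDimensional_of_le (sup_le hW₁ hW)
  rw [← hn]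
  refine (finrank_add_finrank_le hW₁ hW le_sup_left le_sup_right ?_).trans
    (finrank_le_countIn hsa (sup_le hW₁ hW) ?_)
  · intro u hu hu'
    by_contra h0
    have h2 := h₁ u hu
    have h3 : 0 < ‖u‖ ^ 2 := by have := norm_pos_iff.2 h0; positivity
    have h4 : energy H u = E * ‖u‖ ^ 2 := by
      rw [energy, h u hu', inner_smul_left, RCLike.conj_ofReal, RCLike.re_ofReal_mul,
        inner_self_eq_norm_sq]
    nlinarith
  · intro u hu
    obtain ⟨v, hv, w, hw, rfl⟩ := Submodule.mem_sup.1 hu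
    -- Selfadjointness evaluates the cross terms, so adding `w` does not change `energy H v - E *
    -- ‖v‖ ^ 2`, which is at most `(E' - E) * ‖v‖ ^ 2`.
    have hvw : inner 𝕜 (H v) w = (E : 𝕜) * inner 𝕜 v w := by
      have h5 : inner 𝕜 (H v) w = inner 𝕜 v (H w) := hsa.isSymmetric v w
      rw [h5, h w hw, inner_smul_right]
    have he : energy H (v + w) = energy H v + E * (2 * RCLike.re (inner 𝕜 v w) + ‖w‖ ^ 2) := by
      rw [energy, energy, map_add, inner_add_left, inner_add_right, inner_add_right, hvw, h w hw,
        inner_smul_left, inner_smul_left, RCLike.conj_ofReal, map_add, map_add, map_add,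
        RCLike.re_ofReal_mul, RCLike.re_ofReal_mul, RCLike.re_ofReal_mul, inner_self_eq_norm_sq,
        inner_re_symm w v]
      ring
    rw [he, norm_add_sq (𝕜 := 𝕜)]
    have h2 := h₁ v hv
    nlinarith [sq_nonneg ‖v‖, mul_le_mul_of_nonneg_right hE.le (sq_nonneg ‖v‖)]

theorem countIn_le_of_translate (hsa : IsSelfAdjoint H) {t : Lattice d}
    {F F' : Finset (Lattice d)} (hF : ∀ x, x ∈ F ↔ x + t ∈ F')
    (h : ∀ x ∈ F, ∀ y ∈ F, matrixElement H y x = matrixElement H (y + t) (x + t)) (E : ℝ) :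
    countIn H F E ≤ countIn H F' E := by
  obtain ⟨W₁, W₂, hW₁, -, h₁, -, hn, -⟩ := exists_subspaces_countIn hsa F E
  rw [← hn, (Submodule.equivMapOfInjective _ (translate_injective t) W₁).finrank_eq]
  have hFF' : F' = F.map (addRightEmbedding t) := by
    ext x
    simp only [Finset.mem_map, addRightEmbedding_apply]
    constructor
    · exact fun hx => ⟨x - t, (hF _).2 (by simpa using hx), by simp⟩
    · rintro ⟨y, hy, rfl⟩
      exact (hF y).1 hy
  have hin : ∀ w v : EllTwo d 𝓗, v ∈ supportedIn 𝕜 𝓗 (F : Set (Lattice d)) →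
      inner 𝕜 w (translate (𝕜 := 𝕜) t v) = ∑ y ∈ F, inner 𝕜 (w (y + t)) (v y) := by
    intro w v hv
    rw [inner_eq_sum w (translate_mem_supportedIn hF hv), hFF', Finset.sum_map]
    simp
  refine finrank_le_countIn hsa ?_ ?_
  · rintro _ ⟨u, hu, rfl⟩
    exact translate_mem_supportedIn hF (hW₁ hu)
  · rintro _ ⟨u, hu, rfl⟩
    have he : energy H (translate (𝕜 := 𝕜) t u) = energy H u := by
      rw [energy, energy, hin _ _ (hW₁ hu), inner_eq_sum _ (hW₁ hu)]
      congr 1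
      refine Finset.sum_congr rfl fun y hy => ?_
      rw [apply_translate H (hW₁ hu) fun x hx => h x hx y hy]
    have hno : ‖translate (𝕜 := 𝕜) t u‖ ^ 2 = ‖u‖ ^ 2 := by
      rw [← inner_self_eq_norm_sq (𝕜 := 𝕜), ← inner_self_eq_norm_sq (𝕜 := 𝕜), hin _ _ (hW₁ hu),
        inner_eq_sum _ (hW₁ hu)]
      simp
    rw [he, hno]
    exact h₁ u hu

theorem countIn_eq_of_translate (hsa : IsSelfAdjoint H) {t : Lattice d}
    {F F' : Finset (Lattice d)} (hF : ∀ x, x ∈ F ↔ x + t ∈ F')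
    (h : ∀ x ∈ F, ∀ y ∈ F, matrixElement H y x = matrixElement H (y + t) (x + t)) (E : ℝ) :
    countIn H F E = countIn H F' E := by
  refine le_antisymm (countIn_le_of_translate hsa hF h E)
    (countIn_le_of_translate (t := -t) hsa (fun x => ?_) (fun x hx y hy => ?_) E)
  · rw [hF, neg_add_cancel_right]
  · have := h (x + -t) ((hF _).2 (by simpa using hx)) (y + -t) ((hF _).2 (by simpa using hy))
    rw [this]
    simp

/-- The form splits as an orthogonal sum. Adding the subspaces below `E` gives one inequality,
adding those above `E` the other. -/
theorem countIn_union (hsa : IsSelfAdjoint H) {Q Q' : Finset (Lattice d)} (hd : Disjoint Q Q')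
    (h : ∀ x ∈ Q, ∀ y ∈ Q', matrixElement H y x = 0) (E : ℝ) :
    countIn H (Q ∪ Q') E = countIn H Q E + countIn H Q' E := by
  have hQ : supportedIn 𝕜 𝓗 (Q : Set (Lattice d)) ≤ supportedIn 𝕜 𝓗 ((Q ∪ Q' : Finset _) : Set _) :=
    supportedIn_mono (by simp)
  have hQ' : supportedIn 𝕜 𝓗 (Q' : Set (Lattice d)) ≤
      supportedIn 𝕜 𝓗 ((Q ∪ Q' : Finset _) : Set _) :=
    supportedIn_mono (by simp)
  have hzero : ∀ u ∈ supportedIn 𝕜 𝓗 (Q : Set (Lattice d)),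
      ∀ v ∈ supportedIn 𝕜 𝓗 (Q' : Set (Lattice d)), inner 𝕜 u v = 0 := by
    intro u hu v hv
    rw [inner_eq_sum u hv]
    refine Finset.sum_eq_zero fun y hy => ?_
    rw [hu y fun hy' => Finset.disjoint_left.1 hd hy' hy, inner_zero_left]
  have hHzero : ∀ u ∈ supportedIn 𝕜 𝓗 (Q : Set (Lattice d)),
      ∀ v ∈ supportedIn 𝕜 𝓗 (Q' : Set (Lattice d)), inner 𝕜 (H u) v = 0 := by
    intro u hu v hv
    rw [inner_eq_sum (H u) hv]
    refine Finset.sum_eq_zero fun y hy => ?_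
    rw [apply_eq_sum H hu, Finset.sum_eq_zero fun x hx => ?_, inner_zero_left]
    rw [h x hx y hy]
    rfl
  have hen : ∀ u ∈ supportedIn 𝕜 𝓗 (Q : Set (Lattice d)),
      ∀ v ∈ supportedIn 𝕜 𝓗 (Q' : Set (Lattice d)),
        energy H (u + v) = energy H u + energy H v ∧ ‖u + v‖ ^ 2 = ‖u‖ ^ 2 + ‖v‖ ^ 2 := by
    intro u hu v hv
    have h1 := hHzero u hu v hv
    have h2 : inner 𝕜 (H v) u = 0 := by
      have h3 : inner 𝕜 (H u) v = inner 𝕜 u (H v) := hsa.isSymmetric u v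
      rw [← inner_conj_symm, ← h3, h1, map_zero]
    constructor
    · rw [energy, energy, energy, map_add, inner_add_left, inner_add_right, inner_add_right, h1, h2,
        add_zero, zero_add, map_add]
    · rw [norm_add_sq (𝕜 := 𝕜), hzero u hu v hv]
      simp
  have hdis : ∀ u ∈ supportedIn 𝕜 𝓗 (Q : Set (Lattice d)),
      u ∈ supportedIn 𝕜 𝓗 (Q' : Set (Lattice d)) → u = 0 := fun u hu hu' =>
    inner_self_eq_zero.1 (hzero u hu u hu')
  obtain ⟨W₁, W₂, hW₁, hW₂, h₁, h₂, hn, hs⟩ := exists_subspaces_countIn hsa Q E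
  obtain ⟨W₁', W₂', hW₁', hW₂', h₁', h₂', hn', hs'⟩ := exists_subspaces_countIn hsa Q' E
  have hle : countIn H Q E + countIn H Q' E ≤ countIn H (Q ∪ Q') E := by
    have hsup := sup_le (hW₁.trans hQ) (hW₁'.trans hQ')
    have := finiteDimensional_of_le hsup
    rw [← hn, ← hn']
    refine (finrank_add_finrank_le (hW₁.trans hQ) (hW₁'.trans hQ') le_sup_left le_sup_right
      fun u hu hu' => hdis u (hW₁ hu) (hW₁' hu')).trans (finrank_le_countIn hsa hsup ?_)
    intro w hw
    obtain ⟨u, hu, v, hv, rfl⟩ := Submodule.mem_sup.1 hw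
    obtain ⟨e1, e2⟩ := hen u (hW₁ hu) v (hW₁' hv)
    rw [e1, e2, mul_add]
    exact add_le_add (h₁ u hu) (h₁' v hv)
  have hge : countIn H (Q ∪ Q') E + (Module.finrank 𝕜 W₂ + Module.finrank 𝕜 W₂') ≤
      (Q ∪ Q').card * Module.finrank 𝕜 𝓗 := by
    have hsup := sup_le (hW₂.trans hQ) (hW₂'.trans hQ')
    have := finiteDimensional_of_le hsup
    refine (Nat.add_le_add_left (finrank_add_finrank_le (hW₂.trans hQ) (hW₂'.trans hQ')
      le_sup_left le_sup_right fun u hu hu' => hdis u (hW₂ hu) (hW₂' hu')) _).trans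
      (finrank_add_countIn_le hsa hsup ?_)
    intro w hw hw0
    obtain ⟨u, hu, v, hv, rfl⟩ := Submodule.mem_sup.1 hw
    obtain ⟨e1, e2⟩ := hen u (hW₂ hu) v (hW₂' hv)
    rw [e1, e2, mul_add]
    by_cases hu0 : u = 0
    · by_cases hv0 : v = 0
      · exact absurd (by simp [hu0, hv0]) hw0
      · simpa [hu0, energy] using h₂' v hv hv0
    · by_cases hv0 : v = 0
      · simpa [hv0, energy] using h₂ u hu hu0
      · exact add_lt_add (h₂ u hu hu0) (h₂' v hv hv0)
  rw [Finset.card_union_of_disjoint hd, add_mul] at hge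
  omega

theorem countIn_biUnion (hsa : IsSelfAdjoint H) {ι : Type*} (s : Finset ι)
    (B : ι → Finset (Lattice d)) (hd : ∀ i ∈ s, ∀ j ∈ s, i ≠ j → Disjoint (B i) (B j))
    (h : ∀ i ∈ s, ∀ j ∈ s, i ≠ j → ∀ x ∈ B i, ∀ y ∈ B j, matrixElement H y x = 0) (E : ℝ) :
    countIn H (s.biUnion B) E = ∑ i ∈ s, countIn H (B i) E := by
  classical
  induction s using Finset.induction_on with
  | empty =>
    have := countIn_le hsa (∅ : Finset (Lattice d)) E
    simpa using this
  | insert i s hi ih =>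
    have hne : ∀ j ∈ s, i ≠ j := fun j hj h => hi (h ▸ hj)
    rw [Finset.biUnion_insert, Finset.sum_insert hi, countIn_union hsa, ih]
    · exact fun j hj k hk => hd j (Finset.mem_insert_of_mem hj) k (Finset.mem_insert_of_mem hk)
    · exact fun j hj k hk => h j (Finset.mem_insert_of_mem hj) k (Finset.mem_insert_of_mem hk)
    · rw [Finset.disjoint_biUnion_right]
      exact fun j hj => hd i (Finset.mem_insert_self i s) j (Finset.mem_insert_of_mem hj) (hne j hj)
    · intro x hx y hy
      obtain ⟨j, hj, hyj⟩ := Finset.mem_biUnion.1 hy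
      exact h i (Finset.mem_insert_self i s) j (Finset.mem_insert_of_mem hj) (hne j hj) x hx y hyj

end Variational

/-! ### Geometry of boxes and boundaries. -/

section Boxes

variable {d : ℕ}

/-- The box `k + {0, …, a}^d`. -/
def box (a : ℕ) (k : Lattice d) : Finset (Lattice d) :=
  Finset.Icc k fun i => k i + a

theorem mem_box {a : ℕ} {k x : Lattice d} : x ∈ box a k ↔ ∀ i, k i ≤ x i ∧ x i ≤ k i + a := by
  simp only [box, Finset.mem_Icc, Pi.le_def]
  exact forall_and.symm

theorem card_box (a : ℕ) (k : Lattice d) : (box a k).card = (a + 1) ^ d := by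
  have h : ∀ i, (k i + (a : ℤ) + 1 - k i).toNat = a + 1 := fun i => by omega
  simp [box, Pi.card_Icc, h]

theorem box_mono {a b : ℕ} (h : a ≤ b) (k : Lattice d) : box a k ⊆ box b k := by
  intro x hx
  rw [mem_box] at hx ⊢
  intro i
  have := hx i
  omega

theorem add_mem_box {a : ℕ} {k x t : Lattice d} : x + t ∈ box a (k + t) ↔ x ∈ box a k := by
  simp only [mem_box, Pi.add_apply]
  exact forall_congr' fun i => by omega

theorem dist_le_of_mem_box {a : ℕ} {k x : Lattice d} (h : x ∈ box a k) : dist k x ≤ a := by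
  refine (dist_pi_le_iff (by positivity)).2 fun i => ?_
  rw [Int.dist_eq]
  have := mem_box.1 h i
  have h2 : |k i - x i| ≤ (a : ℤ) := abs_le.2 ⟨by omega, by omega⟩
  exact_mod_cast h2

/-- Boxes of side `a` at distinct points of a coset of `(a + s + 1) ℤ^d` are more than `s` apart. -/
theorem lt_dist_of_mem_box {a s : ℕ} {k k' x y : Lattice d} (hne : k ≠ k')
    (hk : ∀ i, (k i : ZMod (a + s + 1)) = k' i) (hx : x ∈ box a k) (hy : y ∈ box a k') :
    (s : ℝ) < dist x y := by
  obtain ⟨i, hi⟩ := Function.ne_iff.1 hne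
  refine lt_of_lt_of_le ?_ (dist_le_pi_dist x y i)
  rw [Int.dist_eq]
  have h1 := mem_box.1 hx i
  have h2 := mem_box.1 hy i
  -- Corners differ by at least `a + s + 1` in this coordinate; moving inside the boxes recovers at
  -- most `a`.
  have hd : ((a + s + 1 : ℕ) : ℤ) ∣ k' i - k i :=
    (ZMod.intCast_eq_intCast_iff_dvd_sub _ _ _).1 (hk i)
  have h3 : ((a + s + 1 : ℕ) : ℤ) ≤ |k' i - k i| :=
    Int.le_of_dvd (abs_pos.2 (sub_ne_zero.2 hi.symm)) ((dvd_abs _ _).2 hd)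
  have h4 : (s : ℤ) < |x i - y i| := by
    push_cast at h3
    rcases abs_cases (k' i - k i) with ⟨h5, h6⟩ | ⟨h5, h6⟩ <;>
    rcases abs_cases (x i - y i) with ⟨h7, h8⟩ | ⟨h7, h8⟩ <;> omega
  exact_mod_cast h4

/-- `Set.ncard` is `0` on infinite sets, so it is monotone only once finiteness is known. -/
theorem finite_boundary (S : ℕ) (Q : Finset (Lattice d)) : (boundary S Q).Finite := by
  refine Set.Finite.subset ((Q.finite_toSet.biUnion fun y _ =>
    ((isCompact_closedBall y (S : ℝ)).finite_of_discrete)).union Q.finite_toSet) ?_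
  rintro x (⟨-, y, hy, hxy⟩ | ⟨hx, -⟩)
  · exact Or.inl (Set.mem_biUnion hy hxy)
  · exact Or.inr hx

/-- The points of `Q` such that the box of side `b` at this point is contained in `Q`. -/
def innerPoints (b : ℕ) (Q : Finset (Lattice d)) : Finset (Lattice d) :=
  Q.filter fun k => box b k ⊆ Q

theorem card_le_card_innerPoints_add (b : ℕ) (Q : Finset (Lattice d)) :
    Q.card ≤ (innerPoints b Q).card + (boundary b Q).ncard := by
  have h : ((Q \ innerPoints b Q : Finset _) : Set (Lattice d)) ⊆ boundary b Q := by
    intro x hx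
    rw [Finset.mem_coe, Finset.mem_sdiff, innerPoints, Finset.mem_filter, not_and] at hx
    obtain ⟨y, hy, hyQ⟩ := Finset.not_subset.1 (hx.2 hx.1)
    exact Or.inr ⟨hx.1, y, hyQ, dist_le_of_mem_box hy⟩
  have h1 := Set.ncard_le_ncard h (finite_boundary b Q)
  rw [Set.ncard_coe_finset] at h1
  have h2 : (Q \ innerPoints b Q).card + (innerPoints b Q).card = Q.card :=
    Finset.card_sdiff_add_card_eq_card (Finset.filter_subset _ _)
  omega

end Boxes

/-! ### Box patterns and their occurrences. -/

section Patterns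

variable {d : ℕ} {A : Type*}

/-- The pattern with domain `{0, …, b}^d` and given colours. -/
def boxPattern (b : ℕ) (p : box b (0 : Lattice d) → A) : Pattern d A := ⟨box b 0, p⟩

theorem isBoxAtOrigin_boxPattern (b : ℕ) (p : box b (0 : Lattice d) → A) :
    (boxPattern b p).IsBoxAtOrigin :=
  ⟨fun _ => b, fun _ => by simp, by simp [boxPattern, box]⟩

/-- The colours that `Λ` shows on the box of side `b` at `k`. -/
def coloursAt (Λ : Lattice d → A) (b : ℕ) (k : Lattice d) : box b (0 : Lattice d) → A :=
  fun y => Λ (k + y)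

theorem occursIn_boxPattern_coloursAt (Λ : Lattice d → A) (b : ℕ) (k : Lattice d) :
    (boxPattern b (coloursAt Λ b k)).OccursIn Λ :=
  ⟨k, fun _ => rfl⟩

-- Occurrence counts are the sizes of the classes into which the colours seen from each point divide
-- the inner points.
open Classical in
theorem count_boxPattern (Λ : Lattice d → A) (b : ℕ) (p : box b (0 : Lattice d) → A)
    (Q : Finset (Lattice d)) :
    (boxPattern b p).count (restrict Λ Q) =
      ((innerPoints b Q).filter fun k => coloursAt Λ b k = p).card := by
  rw [Pattern.count, ← Set.ncard_coe_finset]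
  congr 1
  ext k
  simp only [Set.mem_ofPred_eq, Finset.coe_filter, innerPoints, Finset.mem_filter]
  constructor
  · rintro ⟨hk, h⟩
    refine ⟨⟨hk, fun x hx => ?_⟩, ?_⟩
    · have hx0 : x - k ∈ box b (0 : Lattice d) := by
        rw [← add_mem_box (t := k)]
        simpa using hx
      obtain ⟨h1, -⟩ := h ⟨x - k, hx0⟩
      simpa [restrict] using h1
    · ext y
      obtain ⟨_, h2⟩ := h y
      exact h2
  · rintro ⟨⟨hk, hb⟩, rfl⟩
    refine ⟨hk, fun y => ⟨hb ?_, rfl⟩⟩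
    have := (add_mem_box (t := k)).2 y.2
    rwa [zero_add, add_comm] at this

theorem eq_of_coloursAt_eq {Λ : Lattice d → A} {b : ℕ} {k k' : Lattice d}
    (h : coloursAt Λ b k = coloursAt Λ b k') {z : Lattice d} (hz : z ∈ box b k) :
    Λ (z + (k' - k)) = Λ z := by
  have hz0 : z - k ∈ box b (0 : Lattice d) := by
    rw [← add_mem_box (t := k)]
    simpa using hz
  have := congrFun h ⟨z - k, hz0⟩
  simp only [coloursAt, add_sub_cancel] at this
  rw [this]
  congr 1
  abel

end Patterns

/-! ### Uniform convergence of the normalized counting functions. -/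

section Convergence

variable {𝕜 : Type*} [RCLike 𝕜] {d : ℕ} {A : Type*} {𝓗 : Type*} [NormedAddCommGroup 𝓗]
  [InnerProductSpace 𝕜 𝓗] [CompleteSpace 𝓗] [FiniteDimensional 𝕜 𝓗]
  {H : EllTwo d 𝓗 →L[𝕜] EllTwo d 𝓗}

/-- Comparison of the counting function on `Q` with its average over small boxes. -/
theorem sum_countIn_box_bounds (hsa : IsSelfAdjoint H) {s : ℕ}
    (hs : ∀ x y : Lattice d, (s : ℝ) < dist x y → matrixElement H y x = 0) {a b : ℕ} (hab : a ≤ b)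
    (Q : Finset (Lattice d)) (E : ℝ) :
    ∑ k ∈ innerPoints b Q, countIn H (box a k) E ≤ (a + s + 1) ^ d * countIn H Q E ∧
    (a + s + 1) ^ d * countIn H Q E +
        (innerPoints b Q).card * (a + 1) ^ d * Module.finrank 𝕜 𝓗 ≤
      ∑ k ∈ innerPoints b Q, countIn H (box a k) E +
        (a + s + 1) ^ d * Q.card * Module.finrank 𝕜 𝓗 := by
  classical
  set D := Module.finrank 𝕜 𝓗
  let c : Lattice d → (Fin d → ZMod (a + s + 1)) := fun k i => (k i : ZMod (a + s + 1))
  let G : (Fin d → ZMod (a + s + 1)) → Finset (Lattice d) := fun r =>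
    (innerPoints b Q).filter fun k => c k = r
  let W : (Fin d → ZMod (a + s + 1)) → Finset (Lattice d) := fun r => (G r).biUnion (box a)
  have hfar : ∀ r, ∀ k ∈ G r, ∀ k' ∈ G r, k ≠ k' → ∀ x ∈ box a k, ∀ y ∈ box a k',
      (s : ℝ) < dist x y := by
    intro r k hk k' hk' hne x hx y hy
    refine lt_dist_of_mem_box hne (fun i => ?_) hx hy
    exact congrFun ((Finset.mem_filter.1 hk).2.trans (Finset.mem_filter.1 hk').2.symm) i
  have hdis : ∀ r, ∀ k ∈ G r, ∀ k' ∈ G r, k ≠ k' → Disjoint (box a k) (box a k') := by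
    intro r k hk k' hk' hne
    rw [Finset.disjoint_left]
    intro x hx hx'
    have := hfar r k hk k' hk' hne x hx x hx'
    rw [dist_self] at this
    exact absurd this (not_lt.2 (Nat.cast_nonneg s))
  have hWQ : ∀ r, W r ⊆ Q := by
    intro r x hx
    obtain ⟨k, hk, hxk⟩ := Finset.mem_biUnion.1 hx
    exact (Finset.mem_filter.1 (Finset.mem_filter.1 hk).1).2 (box_mono hab k hxk)
  have hWcard : ∀ r, (W r).card = (G r).card * (a + 1) ^ d := by
    intro r
    rw [Finset.card_biUnion (hdis r), Finset.sum_congr rfl fun k _ => card_box a k,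
      Finset.sum_const, smul_eq_mul]
  have hWcount : ∀ r, countIn H (W r) E = ∑ k ∈ G r, countIn H (box a k) E := fun r =>
    countIn_biUnion hsa (G r) (box a) (hdis r)
      (fun k hk k' hk' hne x hx y hy => hs x y (hfar r k hk k' hk' hne x hx y hy)) E
  have hcard : Fintype.card (Fin d → ZMod (a + s + 1)) = (a + s + 1) ^ d := by
    simp [ZMod.card]
  have hsum : ∑ r, ∑ k ∈ G r, countIn H (box a k) E =
      ∑ k ∈ innerPoints b Q, countIn H (box a k) E :=
    Finset.sum_fiberwise _ _ _
  have hsumcard : ∑ r, (G r).card = (innerPoints b Q).card :=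
    (Finset.card_eq_sum_card_fiberwise fun _ _ => Finset.mem_univ _).symm
  -- Each class `r` gives a packing `W r ⊆ Q` by decoupled boxes, which bounds the count on `Q` from
  -- both sides. Summing over `r` then uses every inner point exactly once.
  have hlow : ∀ r, ∑ k ∈ G r, countIn H (box a k) E ≤ countIn H Q E := fun r =>
    hWcount r ▸ countIn_mono_set hsa (hWQ r) E
  have hup : ∀ r, countIn H Q E + (G r).card * (a + 1) ^ d * D ≤
      ∑ k ∈ G r, countIn H (box a k) E + Q.card * D := by
    intro r
    have h1 := countIn_le_add hsa Q (W r) E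
    have h2 := Finset.card_sdiff_add_card_eq_card (hWQ r)
    rw [← hWcount, ← hWcard, ← h2, add_mul]
    change _ ≤ _ + _ * D at h1
    omega
  constructor
  · rw [← hsum, ← hcard, ← smul_eq_mul, ← Finset.card_univ, ← Finset.sum_const]
    exact Finset.sum_le_sum fun r _ => hlow r
  · have h := Finset.sum_le_sum fun r (_ : r ∈ Finset.univ) => hup r
    simp only [Finset.sum_add_distrib, ← Finset.sum_mul, hsum, hsumcard, Finset.sum_const,
      Finset.card_univ, hcard, smul_eq_mul] at h
    exact h

/-- The counting function of a box depends only on the colours near the box. -/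
theorem countIn_box_eq (hsa : IsSelfAdjoint H) {Λ : Lattice d → A} {M : ℕ}
    (hM : ∀ x y t : Lattice d, (∀ z ∈ cube M x ∪ cube M y, Λ (z + t) = Λ z) →
      matrixElement H y x = matrixElement H (y + t) (x + t)) {a : ℕ} {k k' : Lattice d}
    (h : coloursAt Λ (a + M) k = coloursAt Λ (a + M) k') (E : ℝ) :
    countIn H (box a k) E = countIn H (box a k') E := by
  refine countIn_eq_of_translate (t := k' - k) hsa (fun x => ?_) (fun x hx y hy => ?_) E
  · rw [← add_mem_box (t := k' - k), add_sub_cancel]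
  · have hsub : ∀ w ∈ box a k, ∀ z ∈ cube M w, z ∈ box (a + M) k := by
      intro w hw z hz
      rw [mem_box] at hw ⊢
      intro i
      have h1 := hw i
      have h2 := hz i
      push_cast
      omega
    refine hM x y _ fun z hz => eq_of_coloursAt_eq h ?_
    exact hz.elim (hsub x hx z) (hsub y hy z)

/-- Approximation by convergent sequences makes `f` uniformly Cauchy: four errors of `ε / 4` through
`g` and `G`. -/
theorem exists_tendstoUniformly_of_approx {f : ℕ → ℝ → ℝ}
    (h : ∀ ε : ℝ, 0 < ε → ∃ (g : ℕ → ℝ → ℝ) (G : ℝ → ℝ), TendstoUniformly g G atTop ∧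
      ∀ᶠ j in atTop, ∀ E, |f j E - g j E| < ε) :
    ∃ N : ℝ → ℝ, TendstoUniformly f N atTop := by
  have hc : UniformCauchySeqOn f atTop Set.univ := by
    rw [Metric.uniformCauchySeqOn_iff]
    intro ε hε
    obtain ⟨g, G, hg, hfg⟩ := h (ε / 4) (by positivity)
    obtain ⟨n, hn⟩ := eventually_atTop.1
      (hfg.and (Metric.tendstoUniformly_iff.1 hg (ε / 4) (by positivity)))
    refine ⟨n, fun i hi j hj E _ => ?_⟩
    have h1 := (hn i hi).1 E
    have h2 := (hn i hi).2 E
    have h3 := (hn j hj).1 E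
    have h4 := (hn j hj).2 E
    rw [Real.dist_eq] at h2 h4 ⊢
    rw [abs_lt] at h1 h2 h3 h4 ⊢
    constructor <;> linarith
  have hp : ∀ E, ∃ l, Tendsto (fun j => f j E) atTop (𝓝 l) := fun E =>
    cauchySeq_tendsto_of_complete (hc.cauchySeq (Set.mem_univ E))
  choose N hN using hp
  refine ⟨N, ?_⟩
  rw [← tendstoUniformlyOn_univ]
  exact hc.tendstoUniformlyOn_of_tendsto fun E _ => hN E

theorem tendstoUniformly_sum_mul {ι : Type*} [Fintype ι] {w : ι → ℕ → ℝ} {ν : ι → ℝ}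
    (hw : ∀ p, Tendsto (w p) atTop (𝓝 (ν p))) {h : ι → ℝ → ℝ} {C : ℝ}
    (hC : ∀ p E, |h p E| ≤ C) :
    TendstoUniformly (fun j E => ∑ p, w p j * h p E) (fun E => ∑ p, ν p * h p E) atTop := by
  rw [Metric.tendstoUniformly_iff]
  intro ε hε
  have ht : Tendsto (fun j => ∑ p, |ν p - w p j| * C) atTop (𝓝 0) := by
    have : Tendsto (fun j => ∑ p, |ν p - w p j| * C) atTop (𝓝 (∑ p, |ν p - ν p| * C)) :=
      tendsto_finsetSum _ fun p _ => ((tendsto_const_nhds.sub (hw p)).abs).mul_const C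
    simpa using this
  filter_upwards [ht.eventually_lt_const hε] with j hj E
  refine lt_of_le_of_lt ?_ hj
  rw [Real.dist_eq, ← Finset.sum_sub_distrib]
  refine (Finset.abs_sum_le_sum_abs _ _).trans (Finset.sum_le_sum fun p _ => ?_)
  rw [← sub_mul, abs_mul]
  exact mul_le_mul_of_nonneg_left (hC p E) (abs_nonneg _)

/-- Normalized counting functions converge uniformly. -/
theorem exists_tendstoUniformly_countIn [Finite A] (hsa : IsSelfAdjoint H)
    (hfin : IsFiniteRange H) {Λ : Lattice d → A} (hinv : IsInvariant Λ H)
    {Q : ℕ → Finset (Lattice d)} (hQ : IsVanHove Q)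
    (hfreq : ∀ P : Pattern d A, P.IsBoxAtOrigin → ∃ ν : ℝ, HasFrequency Λ Q P ν) :
    ∃ N : ℝ → ℝ,
      TendstoUniformly (fun j E => (countIn H (Q j) E : ℝ) / ((Q j).card : ℝ)) N atTop := by
  classical
  obtain ⟨s, hs⟩ := hfin.exists_nat
  obtain ⟨M, hM⟩ := hinv
  set D := Module.finrank 𝕜 𝓗 with hD
  refine exists_tendstoUniformly_of_approx fun ε hε => ?_
  -- This is `dim 𝓗` times the proportion of points lost in the gaps between boxes.
  have hlim : Tendsto (fun a : ℕ => (D : ℝ) * (1 - (((a : ℝ) + 1) / (a + s + 1)) ^ d)) atTop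
      (𝓝 0) := by
    have h1 : Tendsto (fun a : ℕ => ((a : ℝ) + 1) / (a + s + 1)) atTop (𝓝 1) := by
      have h2 : Tendsto (fun a : ℕ => 1 - (s : ℝ) / (a + s + 1)) atTop (𝓝 (1 - 0)) := by
        refine tendsto_const_nhds.sub (tendsto_const_nhds.div_atTop ?_)
        exact tendsto_atTop_add_const_right _ _
          (tendsto_atTop_add_const_right _ _ tendsto_natCast_atTop_atTop)
      rw [sub_zero] at h2
      refine h2.congr fun a => ?_
      have : (0 : ℝ) < a + s + 1 := by positivity
      field_simp
      ring
    have := (((h1.pow d).const_sub 1).const_mul (D : ℝ))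
    simpa using this
  obtain ⟨a, ha⟩ := (hlim.eventually_lt_const (half_pos hε)).exists
  have : Fintype (box (a + M) (0 : Lattice d) → A) := Fintype.ofFinite _
  choose ν hν using fun p : box (a + M) (0 : Lattice d) → A =>
    hfreq (boxPattern (a + M) p) (isBoxAtOrigin_boxPattern _ p)
  -- The common count of all boxes showing `p`. The value `0` for a `p` that never occurs is
  -- harmless, as its occurrence counts vanish.
  let n : (box (a + M) (0 : Lattice d) → A) → ℝ → ℝ := fun p E =>
    if h : ∃ k, coloursAt Λ (a + M) k = p then (countIn H (box a h.choose) E : ℝ) else 0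
  have hn : ∀ k E, n (coloursAt Λ (a + M) k) E = countIn H (box a k) E := by
    intro k E
    have h : ∃ k', coloursAt Λ (a + M) k' = coloursAt Λ (a + M) k := ⟨k, rfl⟩
    simp only [n, dif_pos h]
    rw [countIn_box_eq hsa hM h.choose_spec]
  have hnbd : ∀ p E, |n p E| ≤ ((a + 1) ^ d * D : ℕ) := by
    intro p E
    by_cases h : ∃ k, coloursAt Λ (a + M) k = p
    · obtain ⟨k, rfl⟩ := h
      rw [hn, Nat.abs_cast]
      have := countIn_le hsa (box a k) E
      rw [card_box] at this
      exact_mod_cast this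
    · simp only [n, dif_neg h, abs_zero]
      positivity
  have hL : (0 : ℝ) < ((a : ℝ) + s + 1) ^ d := by positivity
  refine ⟨fun j E => ∑ p, ((boxPattern (a + M) p).count (restrict Λ (Q j)) / ((Q j).card : ℝ)) *
      (n p E / ((a : ℝ) + s + 1) ^ d),
    fun E => ∑ p, ν p * (n p E / ((a : ℝ) + s + 1) ^ d),
    tendstoUniformly_sum_mul (fun p => hν p)
      (C := ((a + 1) ^ d * D : ℕ) / ((a : ℝ) + s + 1) ^ d) ?_, ?_⟩
  · intro p E
    rw [abs_div, abs_of_pos hL]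
    exact div_le_div_of_nonneg_right (hnbd p E) hL.le
  have hbd : Tendsto (fun j => (D : ℝ) * (((boundary (a + M) (Q j)).ncard : ℝ) /
      ((Q j).card : ℝ))) atTop (𝓝 0) := by
    simpa using (hQ.2 (a + M)).const_mul (D : ℝ)
  filter_upwards [hbd.eventually_lt_const (half_pos hε)] with j hj E
  have hq : (0 : ℝ) < (Q j).card := by exact_mod_cast (hQ.1 j).card_pos
  obtain ⟨hlow, hup⟩ := sum_countIn_box_bounds hsa hs (Nat.le_add_right a M) (Q j) E
  have hpart := card_le_card_innerPoints_add (a + M) (Q j)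
  have hsum : ∑ p, ((boxPattern (a + M) p).count (restrict Λ (Q j)) / ((Q j).card : ℝ)) *
      (n p E / ((a : ℝ) + s + 1) ^ d) =
      ((∑ k ∈ innerPoints (a + M) (Q j), countIn H (box a k) E : ℕ) : ℝ) /
        (((a : ℝ) + s + 1) ^ d * (Q j).card) := by
    have h1 : ((∑ k ∈ innerPoints (a + M) (Q j), countIn H (box a k) E : ℕ) : ℝ) =
        ∑ p, ((boxPattern (a + M) p).count (restrict Λ (Q j)) : ℝ) * n p E := by
      rw [← Finset.sum_fiberwise (innerPoints (a + M) (Q j)) (coloursAt Λ (a + M))]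
      push_cast
      refine Finset.sum_congr rfl fun p _ => ?_
      rw [count_boxPattern, ← nsmul_eq_mul, ← Finset.sum_const]
      refine Finset.sum_congr rfl fun k hk => ?_
      rw [← (Finset.mem_filter.1 hk).2, hn]
    rw [h1, Finset.sum_div]
    refine Finset.sum_congr rfl fun p _ => ?_
    field_simp
  rw [hsum]
  set X := ∑ k ∈ innerPoints (a + M) (Q j), countIn H (box a k) E
  set c := countIn H (Q j) E
  set g := (innerPoints (a + M) (Q j)).card
  set q := (Q j).card
  set B := (boundary (a + M) (Q j)).ncard
  have hlow' : (X : ℝ) ≤ ((a : ℝ) + s + 1) ^ d * c := by exact_mod_cast hlow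
  have hup' : ((a : ℝ) + s + 1) ^ d * c + g * ((a : ℝ) + 1) ^ d * D ≤
      X + ((a : ℝ) + s + 1) ^ d * q * D := by exact_mod_cast hup
  have hpart' : (q : ℝ) ≤ g + B := by exact_mod_cast hpart
  set L := ((a : ℝ) + s + 1) ^ d with hLdef
  have hle : ((a : ℝ) + 1) ^ d ≤ L :=
    pow_le_pow_left₀ (by positivity) (by linarith [(Nat.cast_nonneg s : (0 : ℝ) ≤ s)]) d
  have heq : (c : ℝ) / q - X / (L * q) = (L * c - X) / (L * q) := by
    field_simp
  -- The first term accounts for the gaps, the second for the points of `Q` that are not inner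
  -- points.
  have hnum : L * c - X ≤ D * (L - ((a : ℝ) + 1) ^ d) * q + D * L * B := by
    have h1 : (q - g : ℝ) * (((a : ℝ) + 1) ^ d * D) ≤ B * (L * D) :=
      (mul_le_mul_of_nonneg_right (by linarith) (by positivity)).trans
        (mul_le_mul_of_nonneg_left (mul_le_mul_of_nonneg_right hle (by positivity)) (by positivity))
    nlinarith
  rw [heq, abs_of_nonneg (div_nonneg (by linarith) (by positivity))]
  calc (L * c - X) / (L * q) ≤ (D * (L - ((a : ℝ) + 1) ^ d) * q + D * L * B) / (L * q) :=
        div_le_div_of_nonneg_right hnum (by positivity)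
    _ = D * (1 - (((a : ℝ) + 1) / (a + s + 1)) ^ d) + D * (B / q) := by
        rw [div_pow, ← hLdef]
        field_simp
    _ < ε := by linarith

end Convergence

/-! ### Copies of a finitely supported eigenfunction. -/

section Translates

variable {𝕜 : Type*} [RCLike 𝕜] {d : ℕ} {𝓗 : Type*} [NormedAddCommGroup 𝓗]
  [InnerProductSpace 𝕜 𝓗]

/-- The translates of a finitely supported function are linearly independent. -/
theorem linearIndependent_translate {u : EllTwo d 𝓗} (hu : u ≠ 0)
    (hfin : {x : Lattice d | u x ≠ 0}.Finite) :
    LinearIndependent 𝕜 fun t : Lattice d => translate (𝕜 := 𝕜) t u := by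
  classical
  rw [linearIndependent_iff']
  intro s g hg t ht
  by_contra hgt
  -- For the lexicographic order, compatible with addition, let `t₀` be the largest shift with
  -- nonzero coefficient and `x₀` the largest point of the support. Only the summand of `t₀` is
  -- nonzero at `x₀ + t₀`.
  obtain ⟨t₀, ht₀, hmax⟩ := (s.filter fun t => g t ≠ 0).exists_max_image (toLex (α := Fin d → ℤ))
    ⟨t, Finset.mem_filter.2 ⟨ht, hgt⟩⟩
  have hne : {x : Lattice d | u x ≠ 0}.Nonempty := by
    by_contra h
    refine hu (lp.ext (funext fun x => ?_))
    by_contra hx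
    exact h ⟨x, hx⟩
  obtain ⟨x₀, hx₀, hxmax⟩ := Set.exists_max_image _ (toLex (α := Fin d → ℤ)) hfin hne
  have h := congrArg (fun w : EllTwo d 𝓗 => w (x₀ + t₀)) hg
  simp only [lp.coeFn_sum, Finset.sum_apply, lp.coeFn_smul, Pi.smul_apply, translate_apply,
    lp.coeFn_zero, Pi.zero_apply] at h
  rw [Finset.sum_eq_single t₀] at h
  · rw [add_sub_cancel_right] at h
    exact (smul_ne_zero (Finset.mem_filter.1 ht₀).2 hx₀) h
  · intro t' ht' hne'
    by_cases hg' : g t' = 0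
    · rw [hg', zero_smul]
    · have hlt : toLex (t' : Fin d → ℤ) < toLex t₀ :=
        lt_of_le_of_ne (hmax t' (Finset.mem_filter.2 ⟨ht', hg'⟩))
          fun he => hne' (toLex.injective he)
      have h0 : u (x₀ + t₀ - t') = 0 := by
        by_contra h1
        have h2 : toLex (x₀ + t₀ - t') ≤ toLex x₀ := hxmax _ h1
        have h3 : toLex (x₀ + t₀ - t') = toLex x₀ + toLex t₀ - toLex t' := rfl
        rw [h3, sub_le_iff_le_add] at h2
        exact absurd (le_of_add_le_add_left h2) (not_le.2 hlt)
      rw [h0, smul_zero]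
  · exact fun h1 => absurd (Finset.mem_filter.1 ht₀).1 h1

/-- Occurrences of the colours around the support of an eigenfunction translate it to
eigenfunctions. -/
theorem HasFinitelySupportedEigenfunction.exists_translates {A : Type*} {Λ : Lattice d → A}
    {H : EllTwo d 𝓗 →L[𝕜] EllTwo d 𝓗} (hfin : IsFiniteRange H) (hinv : IsInvariant Λ H) {E : ℝ}
    (hE : HasFinitelySupportedEigenfunction H E) :
    ∃ (u : EllTwo d 𝓗) (b : ℕ) (k₀ : Lattice d), u ≠ 0 ∧ {x : Lattice d | u x ≠ 0}.Finite ∧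
      ∀ k, coloursAt Λ b k = coloursAt Λ b k₀ →
        translate (𝕜 := 𝕜) (k - k₀) u ∈ supportedIn 𝕜 𝓗 (box b k : Set (Lattice d)) ∧
        H (translate (𝕜 := 𝕜) (k - k₀) u) = (E : 𝕜) • translate (𝕜 := 𝕜) (k - k₀) u := by
  obtain ⟨u, hu, hsupp, hHu⟩ := hE
  obtain ⟨s, hs⟩ := hfin.exists_nat
  obtain ⟨M, hM⟩ := hinv
  set F := hsupp.toFinset with hF
  have huF : u ∈ supportedIn 𝕜 𝓗 (F : Set (Lattice d)) := by
    intro x hx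
    by_contra h
    exact hx (by simpa [hF] using h)
  set c := F.sup fun x => Finset.univ.sup fun i => (x i).natAbs with hc
  have hFc : ∀ x ∈ F, ∀ i, (x i).natAbs ≤ c := fun x hx i =>
    (Finset.le_sup (f := fun i => (x i).natAbs) (Finset.mem_univ i)).trans
      (Finset.le_sup (f := fun x : Lattice d => Finset.univ.sup fun i => (x i).natAbs) hx)
  -- The box `{-(c + s), …, c + s + M}^d` contains the support, its `s`-neighbourhood and the cubes
  -- `C_M` at all those points, hence all colours that determine `H u`.
  set k₀ : Lattice d := fun _ => -((c : ℤ) + s) with hk₀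
  set b := 2 * (c + s) + M with hb
  have hcube : ∀ y : Lattice d, (∀ i, (y i).natAbs ≤ c + s) → ∀ z ∈ cube M y, z ∈ box b k₀ := by
    intro y hy z hz
    rw [mem_box]
    intro i
    have h1 := hy i
    have h2 := hz i
    simp only [hk₀, hb]
    push_cast
    omega
  have hFb : ∀ x ∈ F, x ∈ box b k₀ := by
    intro x hx
    rw [mem_box]
    intro i
    have h1 := hFc x hx i
    simp only [hk₀, hb]
    push_cast
    omega
  refine ⟨u, b, k₀, hu, hsupp, fun k hk => ⟨?_, ?_⟩⟩
  · have h1 : u ∈ supportedIn 𝕜 𝓗 (box b k₀ : Set (Lattice d)) :=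
      supportedIn_mono (fun x hx => hFb x hx) huF
    refine translate_mem_supportedIn (fun x => ?_) h1
    rw [← add_mem_box (t := k - k₀), add_sub_cancel]
  · have hmat : ∀ y, ∀ x ∈ F,
        matrixElement H y x = matrixElement H (y + (k - k₀)) (x + (k - k₀)) := by
      intro y x hx
      by_cases hxy : dist x y ≤ s
      · have hy : ∀ i, (y i).natAbs ≤ c + s := by
          intro i
          have h1 := hFc x hx i
          have h2 := (dist_le_pi_dist x y i).trans hxy
          rw [Int.dist_eq] at h2
          have h3 : |x i - y i| ≤ (s : ℤ) := by exact_mod_cast h2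
          rw [abs_le] at h3
          omega
        refine hM x y _ fun z hz => eq_of_coloursAt_eq hk.symm ?_
        exact hz.elim (hcube x (fun i => (hFc x hx i).trans (Nat.le_add_right _ _)) z)
          (hcube y hy z)
      · rw [hs x y (not_le.1 hxy), hs _ _ (by rw [dist_add_right]; exact not_le.1 hxy)]
    ext z
    obtain ⟨y, rfl⟩ : ∃ y, z = y + (k - k₀) := ⟨z - (k - k₀), by simp⟩
    rw [apply_translate H huF (hmat y), hHu]
    simp

end Translates

/-! ### The limit as a distribution function, and its discontinuities. -/

section Compression

variable {𝕜 : Type*} [RCLike 𝕜] {d : ℕ} {𝓗 : Type*} [NormedAddCommGroup 𝓗]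
  [InnerProductSpace 𝕜 𝓗] [CompleteSpace 𝓗] {H : EllTwo d 𝓗 →L[𝕜] EllTwo d 𝓗}

theorem compression_apply (Q : Finset (Lattice d)) (u : supportedIn 𝕜 𝓗 (Q : Set (Lattice d)))
    {y : Lattice d} (hy : y ∈ Q) :
    (compression H Q u : EllTwo d 𝓗) y = H (u : EllTwo d 𝓗) y := by
  refine ext_inner_right 𝕜 fun v => ?_
  have hv : lp.single 2 y v ∈ supportedIn 𝕜 𝓗 (Q : Set (Lattice d)) := by
    intro x hx
    refine lp.single_apply_ne _ _ _ ?_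
    rintro rfl
    exact hx hy
  have h : inner 𝕜 (compression H Q u : EllTwo d 𝓗) (lp.single 2 y v) =
      inner 𝕜 (H (u : EllTwo d 𝓗)) (lp.single 2 y v) := inner_compression H Q u ⟨_, hv⟩
  rwa [lp.inner_single_right, lp.inner_single_right] at h

theorem IsIDS.unique {Q : ℕ → Finset (Lattice d)} {N N' : ℝ → ℝ} (hN : IsIDS H Q N)
    (hN' : IsIDS H Q N') : N = N' :=
  funext fun E => tendsto_nhds_unique (hN.2.tendsto_at E) (hN'.2.tendsto_at E)

variable [FiniteDimensional 𝕜 𝓗]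

/-- Without finitely supported eigenfunctions, eigenfunctions of the compression are determined by
their values near the boundary. -/
theorem finrank_eigenspace_compression_le {s : ℕ}
    (hs : ∀ x y : Lattice d, (s : ℝ) < dist x y → matrixElement H y x = 0) {E : ℝ}
    (hE : ¬ HasFinitelySupportedEigenfunction H E) (Q : Finset (Lattice d)) :
    Module.finrank 𝕜 (Module.End.eigenspace (compression H Q).toLinearMap (E : 𝕜)) ≤
      (boundary s Q).ncard * Module.finrank 𝕜 𝓗 := by
  classical
  set W := (Module.End.eigenspace (compression H Q).toLinearMap (E : 𝕜)).map
    (Submodule.subtype _) with hW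
  have hWQ : W ≤ supportedIn 𝕜 𝓗 (Q : Set (Lattice d)) := Submodule.map_subtype_le _ _
  have := finiteDimensional_of_le hWQ
  set F := Q.filter fun x => ∃ y, y ∉ Q ∧ dist x y ≤ s with hF
  have hFb : (F : Set (Lattice d)) ⊆ boundary s Q := fun x hx =>
    Or.inr (Finset.mem_filter.1 hx)
  have hFcard : F.card ≤ (boundary s Q).ncard := by
    rw [← Set.ncard_coe_finset]
    exact Set.ncard_le_ncard hFb (finite_boundary s Q)
  -- If `u` vanishes on the inner layer `F`, then `H u = E u` also outside `Q`: points of `Q` within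
  -- range of such a point lie in `F`.
  have hbot : W ⊓ supportedIn 𝕜 𝓗 ((F : Set (Lattice d))ᶜ) = ⊥ := by
    rw [Submodule.eq_bot_iff]
    rintro _ ⟨⟨u, hu, rfl⟩, huF⟩
    by_contra h0
    refine hE ⟨(u : EllTwo d 𝓗), h0, Q.finite_toSet.subset fun x hx => ?_, ?_⟩
    · by_contra hxQ
      exact hx (u.2 x hxQ)
    · ext y
      by_cases hy : y ∈ Q
      · rw [← compression_apply Q u hy]
        have h1 : compression H Q u = (E : 𝕜) • u := Module.End.mem_eigenspace_iff.1 hu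
        rw [h1]
        rfl
      · rw [apply_eq_sum H u.2, lp.coeFn_smul, Pi.smul_apply, u.2 y hy, smul_zero]
        refine Finset.sum_eq_zero fun x hx => ?_
        by_cases hxy : dist x y ≤ s
        · have h1 : (u : EllTwo d 𝓗) x = 0 :=
            huF x fun h => h (Finset.mem_filter.2 ⟨hx, y, hy, hxy⟩)
          rw [h1, map_zero]
        · rw [hs x y (not_le.1 hxy)]
          rfl
  have h := finrank_le_finrank_inf_add W F
  rw [hbot, finrank_bot, zero_add, hW, Submodule.finrank_map_subtype_eq] at h
  exact h.trans (Nat.mul_le_mul_right _ hFcard)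

theorem eventually_countIn_right (hsa : IsSelfAdjoint H) (Q : Finset (Lattice d)) (E : ℝ) :
    ∀ᶠ E' in 𝓝[≥] E, countIn H Q E' = countIn H Q E :=
  eventually_eigenvalueCount_right (isSymmetric_compression hsa Q) E

theorem isIDS_of_tendstoUniformly (hsa : IsSelfAdjoint H) {Q : ℕ → Finset (Lattice d)}
    (hQ : ∀ j, (Q j).Nonempty) {N : ℝ → ℝ}
    (hN : TendstoUniformly (fun j E => (countIn H (Q j) E : ℝ) / ((Q j).card : ℝ)) N atTop) :
    IsIDS H Q N := by
  refine ⟨?_, hN⟩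
  have hq : ∀ j, (0 : ℝ) < (Q j).card := fun j => by exact_mod_cast (hQ j).card_pos
  have hmono : Monotone N := fun E E' h =>
    le_of_tendsto_of_tendsto' (hN.tendsto_at E) (hN.tendsto_at E') fun j =>
      div_le_div_of_nonneg_right (by exact_mod_cast countIn_mono hsa (Q j) h) (hq j).le
  have hbot : ∀ E < -‖H‖, N E = 0 := fun E hE =>
    tendsto_nhds_unique (hN.tendsto_at E) (by simp [countIn_of_lt_neg_norm hsa _ hE])
  have htop : ∀ E, ‖H‖ ≤ E → N E = Module.finrank 𝕜 𝓗 := by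
    intro E hE
    refine tendsto_nhds_unique (hN.tendsto_at E) (tendsto_const_nhds.congr fun j => ?_)
    have := (hq j).ne'
    rw [countIn_of_norm_le hsa _ hE]
    push_cast
    field_simp
  have hcont : ∀ E, ContinuousWithinAt N (Set.Ici E) E := by
    intro E
    refine Metric.tendsto_nhds.2 fun ε hε => ?_
    -- One `j` suffices: the counting function is constant just to the right of `E`, and the uniform
    -- error handles both endpoints.
    obtain ⟨j, hj⟩ := (Metric.tendstoUniformly_iff.1 hN (ε / 2) (half_pos hε)).exists
    filter_upwards [eventually_countIn_right hsa (Q j) E] with E' hE'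
    have h1 := hj E'
    have h2 := hj E
    rw [hE'] at h1
    have h3 := dist_triangle_right (N E') (N E) (countIn H (Q j) E / ((Q j).card : ℝ))
    linarith
  let f : StieltjesFunction ℝ := ⟨N, hmono, hcont⟩
  have hf0 : Tendsto f atBot (𝓝 0) := by
    refine tendsto_const_nhds.congr' ?_
    filter_upwards [eventually_lt_atBot (-‖H‖)] with E hE using (hbot E hE).symm
  have hf1 : Tendsto f atTop (𝓝 (Module.finrank 𝕜 𝓗 : ℝ)) := by
    refine tendsto_const_nhds.congr' ?_
    filter_upwards [eventually_ge_atTop ‖H‖] with E hE using (htop E hE).symm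
  refine ⟨f.measure, ?_, fun E => ?_⟩
  · rw [f.measure_univ hf0 hf1, sub_zero, ENNReal.ofReal_natCast]
  · have h0 : 0 ≤ N E := ge_of_tendsto' (hN.tendsto_at E) fun j => by positivity
    rw [Measure.real, f.measure_Iic hf0, sub_zero]
    exact (ENNReal.toReal_ofReal h0).symm

/-- The finite-volume jump at `E` is at most `dim 𝓗 * |∂Q| / |Q|`; uniform convergence carries this
smallness to `N`. -/
theorem IsIDS.continuousAt (hsa : IsSelfAdjoint H) (hfin : IsFiniteRange H)
    {Q : ℕ → Finset (Lattice d)} (hQ : IsVanHove Q) {N : ℝ → ℝ} (hN : IsIDS H Q N) {E : ℝ}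
    (hE : ¬ HasFinitelySupportedEigenfunction H E) : ContinuousAt N E := by
  obtain ⟨s, hs⟩ := hfin.exists_nat
  refine Metric.tendsto_nhds.2 fun ε hε => ?_
  have hbd : Tendsto (fun j => ((boundary s (Q j)).ncard : ℝ) / ((Q j).card : ℝ) *
      Module.finrank 𝕜 𝓗) atTop (𝓝 0) := by
    simpa using (hQ.2 s).mul_const (Module.finrank 𝕜 𝓗 : ℝ)
  have hε' : 0 < ε / 4 := by positivity
  obtain ⟨j, hj, hjb⟩ := ((Metric.tendstoUniformly_iff.1 hN.2 (ε / 4) hε').and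
    (hbd.eventually_lt_const hε')).exists
  change ∀ E', dist (N E') (countIn H (Q j) E' / ((Q j).card : ℝ)) < ε / 4 at hj
  have hq : (0 : ℝ) < (Q j).card := by exact_mod_cast (hQ.1 j).card_pos
  have h1 := hj E
  rw [Real.dist_eq, abs_lt] at h1
  rw [← nhdsLT_sup_nhdsGE, eventually_sup]
  constructor
  · filter_upwards [eventually_eigenvalueCount_left (isSymmetric_compression hsa (Q j)) E,
      self_mem_nhdsWithin] with E' hE' hlt
    have h2 := hj E'
    rw [Real.dist_eq, abs_lt] at h2 ⊢
    have h3 : (countIn H (Q j) E' : ℝ) ≤ countIn H (Q j) E := by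
      exact_mod_cast countIn_mono hsa (Q j) hlt.le
    have h4 : (countIn H (Q j) E : ℝ) ≤ countIn H (Q j) E' +
        (boundary s (Q j)).ncard * Module.finrank 𝕜 𝓗 := by
      exact_mod_cast hE'.trans
        (Nat.add_le_add_left (finrank_eigenspace_compression_le hs hE (Q j)) _)
    have h5 := div_le_div_of_nonneg_right h3 hq.le
    have h6 := div_le_div_of_nonneg_right h4 hq.le
    rw [add_div, mul_div_right_comm] at h6
    constructor <;> linarith
  · filter_upwards [eventually_countIn_right hsa (Q j) E] with E' hE'
    have h2 := hj E'
    rw [hE'] at h2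
    rw [Real.dist_eq, abs_lt] at h2 ⊢
    constructor <;> linarith

theorem IsIDS.not_continuousAt {A : Type*} {Λ : Lattice d → A} (hsa : IsSelfAdjoint H)
    (hfin : IsFiniteRange H) (hinv : IsInvariant Λ H) {Q : ℕ → Finset (Lattice d)}
    (hpos : ∀ P : Pattern d A, P.IsBoxAtOrigin → P.OccursIn Λ →
      ∃ ν : ℝ, 0 < ν ∧ HasFrequency Λ Q P ν) {N : ℝ → ℝ} (hN : IsIDS H Q N) {E : ℝ}
    (hE : HasFinitelySupportedEigenfunction H E) : ¬ ContinuousAt N E := by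
  classical
  obtain ⟨u, b, k₀, hu, hsupp, htr⟩ := hE.exists_translates hfin hinv
  obtain ⟨ν, hν, hfr⟩ := hpos _ (isBoxAtOrigin_boxPattern b (coloursAt Λ b k₀))
    (occursIn_boxPattern_coloursAt Λ b k₀)
  -- The copies of `u` inside `Q j` span eigenfunctions, so the count rises between `E'` and `E` by
  -- at least the number of occurrences; `ν` does not depend on `E'`.
  have hjump : ∀ E' < E, ν ≤ N E - N E' := by
    intro E' hE'
    refine le_of_tendsto_of_tendsto' hfr ((hN.2.tendsto_at E).sub (hN.2.tendsto_at E')) fun j => ?_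
    rw [← sub_div]
    refine div_le_div_of_nonneg_right ?_ (Nat.cast_nonneg _)
    rw [count_boxPattern]
    set G := (innerPoints b (Q j)).filter fun k => coloursAt Λ b k = coloursAt Λ b k₀ with hG
    let v : G → EllTwo d 𝓗 := fun k => translate (𝕜 := 𝕜) ((k : Lattice d) - k₀) u
    have hinj : Function.Injective fun k : G => (k : Lattice d) - k₀ := fun k k' h =>
      Subtype.ext (sub_left_injective h)
    have hv : LinearIndependent 𝕜 v := (linearIndependent_translate hu hsupp).comp _ hinj
    have hsub : Submodule.span 𝕜 (Set.range v) ≤ supportedIn 𝕜 𝓗 (Q j : Set (Lattice d)) := by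
      rw [Submodule.span_le]
      rintro _ ⟨k, rfl⟩
      obtain ⟨h1, h2⟩ := Finset.mem_filter.1 k.2
      exact supportedIn_mono (by exact_mod_cast (Finset.mem_filter.1 h1).2) (htr k h2).1
    have heig : ∀ w ∈ Submodule.span 𝕜 (Set.range v), H w = (E : 𝕜) • w := by
      intro w hw
      induction hw using Submodule.span_induction with
      | mem w hw =>
        obtain ⟨k, rfl⟩ := hw
        exact (htr k (Finset.mem_filter.1 k.2).2).2
      | zero => simp
      | add w w' _ _ h h' => rw [map_add, h, h', smul_add]
      | smul c w _ h => rw [map_smul, h, smul_comm]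
    have h := countIn_add_finrank_le hsa hE' hsub heig
    rw [finrank_span_eq_card hv, Fintype.card_coe] at h
    change (G.card : ℝ) ≤ (countIn H (Q j) E : ℝ) - countIn H (Q j) E'
    have h' : (countIn H (Q j) E' : ℝ) + G.card ≤ countIn H (Q j) E := by exact_mod_cast h
    linarith
  intro hc
  have h0 : Tendsto (fun E' => N E - N E') (𝓝[<] E) (𝓝 (N E - N E)) :=
    tendsto_const_nhds.sub (hc.mono_left nhdsWithin_le_nhds)
  rw [sub_self] at h0
  exact absurd (ge_of_tendsto h0 (eventually_mem_nhdsWithin.mono hjump)) (not_le.2 hν)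

end Compression

end FiniteRange

end

theorem corollary4p5
    {𝕜 : Type*} [RCLike 𝕜] (d : ℕ) {A : Type*} [Finite A]
    {𝓗 : Type*} [NormedAddCommGroup 𝓗] [InnerProductSpace 𝕜 𝓗] [CompleteSpace 𝓗]
    [FiniteDimensional 𝕜 𝓗]
    (Λ : FiniteRange.Lattice d → A)
    (Q : ℕ → Finset (FiniteRange.Lattice d)) (hQ : FiniteRange.IsVanHove Q)
    (hfreq : ∀ P : FiniteRange.Pattern d A, P.IsBoxAtOrigin →
      ∃ ν : ℝ, FiniteRange.HasFrequency Λ Q P ν)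
    (H : FiniteRange.EllTwo d 𝓗 →L[𝕜] FiniteRange.EllTwo d 𝓗)
    (hsa : IsSelfAdjoint H)
    (hfin : FiniteRange.IsFiniteRange H)
    (hinv : FiniteRange.IsInvariant Λ H)
    (hpos : ∀ P : FiniteRange.Pattern d A, P.IsBoxAtOrigin → P.OccursIn Λ →
      ∃ ν : ℝ, 0 < ν ∧ FiniteRange.HasFrequency Λ Q P ν) :
    (∃! N : ℝ → ℝ, FiniteRange.IsIDS H Q N) ∧
    ∀ N : ℝ → ℝ, FiniteRange.IsIDS H Q N →
      ∀ E : ℝ, ¬ ContinuousAt N E ↔ FiniteRange.HasFinitelySupportedEigenfunction H E := by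
  obtain ⟨N, hN⟩ := FiniteRange.exists_tendstoUniformly_countIn hsa hfin hinv hQ hfreq
  refine ⟨⟨N, FiniteRange.isIDS_of_tendstoUniformly hsa hQ.1 hN, fun N' hN' =>
    hN'.unique (FiniteRange.isIDS_of_tendstoUniformly hsa hQ.1 hN)⟩, fun N' hN' E => ⟨?_, ?_⟩⟩
  · intro h
    by_contra hE
    exact h (hN'.continuousAt hsa hfin hQ hE)
  · exact hN'.not_continuousAt hsa hfin hinv hpos
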